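/- **Theorem (Bounded $O(1)$ regret for online RLHF).** *Setting.* Let $\mathcal X$ be a measurable (context) space with a probability measure $d_0$, let $\mathcal A$ be a separable metric (action) space with its Borel $\sigma$-algebra, and let $\pi_0$ be a Markov kernel from $\mathcal X$ to $\mathcal A$ (the reference policy). Write $S_x=\operatorname{supp}\pi_0(\cdot\mid x)$ and $\|R\|_{\infty,\operatorname{supp}(\pi_0)}=\sup_{x\in\mathcal X,\,a\in S_x}|R(x,a)|$. Fix $K\ge 2$ and $\eta>0$. Let $(R_p)_{p\in\mathcal P}$ be a family of measurable functions $R_p:\mathcal X\times\mathcal A\to\mathbb R$ that are centered, $\int R_p(x,a)\,\pi_0(da\mid x)=0$ for all $x$, and put $\mathcal F_{\mathcal P}=\{R_p:p\in\mathcal P\}$. For every $R\in\mathcal F_{\mathcal P}\cup\{0\}$ fix a measurable selector $a_R(x)\in\arg\max_{a\in S_x}R(x,a)$, and write $a_p=a_{R_p}$. Assume: (C1) the elements of $\mathcal F_{\mathcal P}$ have finite norm $\|\cdot\|_{\infty,\operatorname{supp}(\pi_0)}$, $\mathcal F_{\mathcal P}$ is compact for it, and for every $R\in\mathcal F_{\mathcal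 P}$ the map $a\mapsto R(x,a)$ is continuous on $S_x$ for $d_0$-a.e. $x$; (C2) there is $\Delta_{\min}>0$ such that for every $p\in\mathcal P$, for $d_0$-a.e. $x$, $R_p(x,a_p(x))-R_p(x,a)\ge\Delta_{\min}$ for all $a\in S_x$ with $a\ne a_p(x)$. *Losses and regret.* For $v\in\mathbb R^K$ and $y\in\{1,\dots,K\}$ let $\ell(v,y)=\log\big(\sum_k e^{v_k}\big)-v_y$. The multinomial logit (MNL) model of a reward $R$ is $P_R(y=k\mid x,a_1,\dots,a_K)=e^{R(x,a_k)}/\sum_l e^{R(x,a_l)}$. Put $\mathcal G_p(R)=\mathbb E_{X\sim d_0}[R_p(X,a_p(X))-R_p(X,a_R(X))]$ and $\mathcal L_p(R)=\mathbb E[\ell((R(X,A_1),\dots,R(X,A_K)),Y)]$, where $X\sim d_0$, $A_1,\dots,A_K$ are i.i.d. from $\pi_0(\cdot\mid X)$ given $X$, and $Y\sim P_{R_p}(\cdot\mid X,A_1,\dots,A_K)$. *Greedy loop under truth $p$.* Start with $\widehat R_0\equiv 0$. In round $t=1,2,\dots$ draw $x_t\sim d_0$ (independently of the past), then $a_{t,1},\dots,a_{t,K}$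 i.i.d. from $\pi_t(\cdot\mid x_t)$, then $y_t\sim P_{R_p}(\cdot\mid x_t,a_{t,1},\dots,a_{t,K})$, where $\pi_t(da\mid x)\propto e^{\eta\widehat R_{t-1}(x,a)}\,\pi_0(da\mid x)$. Then $\widehat R_t\in\arg\min_{R\in\mathcal F_{\mathcal P}}\frac1t\sum_{s=1}^t\ell\big((R(x_s,a_{s,1}),\dots,R(x_s,a_{s,K})),y_s\big)$ is chosen by a fixed rule measurable in the data (jointly with the context and the action). For $T\ge1$ let $\mathrm{Regret}_{0,p}(T)=\sum_{t=0}^{T-1}\mathbb E_p[\mathcal G_p(\widehat R_t)]$. *Conclusion.* The expectations $\mathbb E_p[\mathcal G_p(\widehat R_t)]$ exist, and $$\sup_{p\in\mathcal P}\sup_{T\ge1}\mathrm{Regret}_{0,p}(T)<\infty .$$ More precisely, there is $\varepsilon_0>0$ with (i) $\mathcal G_p(R_q)\in\{0\}\cup[\varepsilon_0,\infty)$ for all $p,q\in\mathcal P$, and for every $\varepsilon_0>0$ there is $\gamma_{\mathcal P,\varepsilon_0}>0$ with (ii) $\mathcal G_p(R_q)\ge\varepsilon_0\Rightarrow\mathcal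 L_p(R_q)-\mathcal L_p(R_p)\ge\gamma_{\mathcal P,\varepsilon_0}$ for all $p,q\in\mathcal P$. For every $\varepsilon_0>0$ satisfying (i) and every $\gamma_{\mathcal P,\varepsilon_0}>0$ satisfying (ii), put $B=\sup_{R\in\mathcal F_{\mathcal P}}\|R\|_{\infty,\operatorname{supp}(\pi_0)}$, $\beta=e^{2\eta B}$, $\gamma=\beta^{-K}\gamma_{\mathcal P,\varepsilon_0}$, let $N_\gamma$ be the $\gamma/32$-covering number of $\mathcal F_{\mathcal P}$ (closed balls with centers in $\mathcal F_{\mathcal P}$) for $\|\cdot\|_{\infty,\operatorname{supp}(\pi_0)}$, and put $c_\gamma=\dfrac{\gamma^2}{128(\log K+2B)^2}$ and $\Delta_{\max}=\sup_{p\in\mathcal P}\sup_{x\in\mathcal X}\sup_{a\in S_x}\big(R_p(x,a_p(x))-R_p(x,a)\big)$. Then $N_\gamma<\infty$ and $$\sup_{p\in\mathcal P}\sup_{T\ge1}\mathrm{Regret}_{0,p}(T)\le\Delta_{\max}\Big(1+\Big\lceil\tfrac1{c_\gamma}\log(2N_\gamma)\Big\rceil+\tfrac1{e^{c_\gamma}-1}\Big).$$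 -/

import Mathlib

open MeasureTheory ProbabilityTheory
open scoped NNReal ENNReal UniformConvergence

namespace GreedyRLHF

noncomputable section

/-! ### Multinomial logit choice -/

/-- MNL choice probabilities `exp (v k) / ∑ l, exp (v l)` of a reward vector `v`. -/
def mnlProb {K : ℕ} (v : Fin K → ℝ) (k : Fin K) : ℝ :=
  Real.exp (v k) / ∑ l, Real.exp (v l)

/-- Multinomial log-loss `log (∑ k, exp (v k)) - v y`. -/
def mnlLoss {K : ℕ} (v : Fin K → ℝ) (y : Fin K) : ℝ :=
  Real.log (∑ k, Real.exp (v k)) - v y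

/-! ### Data -/

/-- One round of interaction `(x, (a₁, …, a_K), y)`: context, slate, preferred index. -/
abbrev Round (X A : Type*) (K : ℕ) : Type _ := X × (Fin K → A) × Fin K

/-- The data of the first `t` rounds, in order. -/
abbrev History (X A : Type*) (K t : ℕ) : Type _ := Fin t → Round X A K

/-- The log-loss `ℓ(v_R, y)` of the reward `R` on one round. -/
def roundLoss {X A : Type*} {K : ℕ} (R : X → A → ℝ) (z : Round X A K) : ℝ :=
  mnlLoss (fun k => R z.1 (z.2.1 k)) z.2.2

/-- Empirical preference risk of `R` on `t` rounds of data. -/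
def empRisk {X A : Type*} {K t : ℕ} (h : History X A K t) (R : X → A → ℝ) : ℝ :=
  (1 / (t : ℝ)) * ∑ s, roundLoss R (h s)

/-! ### Support of the reference policy and the sup-norm on it -/

section Support

variable {X A : Type*} [MeasurableSpace X] [MeasurableSpace A] [TopologicalSpace A]

/-- The support graph `{(x, a) : a ∈ supp π₀(· | x)}`. -/
def suppGraph (π₀ : Kernel X A) : Set (X × A) := {z | z.2 ∈ (π₀ z.1).support}

/-- The restriction of a reward to the support graph, as a point of the space of real functions on
the support graph; Mathlib's extended distance on this space is the supremum distance
`⨆ z, |f z - g z|`. -/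
def onSupport (π₀ : Kernel X A) (R : X → A → ℝ) : suppGraph π₀ →ᵤ ℝ :=
  UniformFun.ofFun fun z => R z.1.1 z.1.2

/-- The reward class, as a set of functions on the support graph with the supremum distance. -/
def classOnSupport {P : Type*} (π₀ : Kernel X A) (R : P → X → A → ℝ) : Set (suppGraph π₀ →ᵤ ℝ) :=
  Set.range fun p => onSupport π₀ (R p)

/-- The envelope `sup_p ‖R_p‖_{∞, supp π₀}`. -/
def envelope {P : Type*} (π₀ : Kernel X A) (R : P → X → A → ℝ) : ℝ :=
  ⨆ q : P × suppGraph π₀, |R q.1 q.2.1.1 q.2.1.2|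

/-- Compact continuous reward class: every `R_p` has finite sup-norm on the support graph, the class
is compact for this norm, and every `R_p(x, ·)` is continuous on `supp π₀(· | x)` for `d₀`-a.e.
context `x`. -/
structure CompactContinuous {P : Type*} (d₀ : Measure X) (π₀ : Kernel X A) (R : P → X → A → ℝ) :
    Prop where
  bounded : ∀ p, ∃ C : ℝ, ∀ z ∈ suppGraph π₀, |R p z.1 z.2| ≤ C
  compact : IsCompact (classOnSupport π₀ R)
  continuous : ∀ p, ∀ᵐ x ∂d₀, ContinuousOn (R p x) (π₀ x).support

/-! ### Temperature-zero selectors, reward gap, regret -/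

/-- `sel` assigns to every reward `R` of the class `F` a measurable selector
`x ↦ sel R x ∈ argmax_{a ∈ supp π₀(· | x)} R(x, a)`. -/
def IsArgmaxSelector (π₀ : Kernel X A) (F : Set (X → A → ℝ)) (sel : (X → A → ℝ) → X → A) : Prop :=
  ∀ R ∈ F, Measurable (sel R) ∧
    ∀ x, sel R x ∈ (π₀ x).support ∧ ∀ a ∈ (π₀ x).support, R x a ≤ R x (sel R x)

/-- Uniform reward gap: there is `Δ > 0` such that for every truth `p`, for `d₀`-a.e. `x`, the
maximizer `a_p(x)` beats every other action of the support by at least `Δ` (in particular it is the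
unique maximizer). -/
def HasRewardGap {P : Type*} (d₀ : Measure X) (π₀ : Kernel X A) (sel : (X → A → ℝ) → X → A)
    (R : P → X → A → ℝ) : Prop :=
  ∃ Δ : ℝ, 0 < Δ ∧ ∀ p, ∀ᵐ x ∂d₀, ∀ a ∈ (π₀ x).support, a ≠ sel (R p) x →
    R p x a + Δ ≤ R p x (sel (R p) x)

/-- `Δ_max`: the supremum of `R_p(x, a_p(x)) - R_p(x, a)` over truths `p`, contexts `x` and actions
`a ∈ supp π₀(· | x)`. -/
def deltaMax {P : Type*} (π₀ : Kernel X A) (sel : (X → A → ℝ) → X → A) (R : P → X → A → ℝ) : ℝ :=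
  ⨆ q : P × suppGraph π₀,
    (R q.1 q.2.1.1 (sel (R q.1) q.2.1.1) - R q.1 q.2.1.1 q.2.1.2)

end Support

section Loop

variable {X A : Type*} [MeasurableSpace X] [MeasurableSpace A]

/-- One-step temperature-zero regret of acting with the selector of `R` when the true reward is
`Rstar`. -/
def oneStepRegret (d₀ : Measure X) (sel : (X → A → ℝ) → X → A) (Rstar R : X → A → ℝ) : ℝ :=
  ∫ x, (Rstar x (sel Rstar x) - Rstar x (sel R x)) ∂d₀

/-- The law of a round `(x, a, y)` with given context `x` and slate `a`, the preferred index `y` being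
drawn from the MNL choice probabilities of the true reward `Rstar`. -/
def choiceLaw {K : ℕ} (Rstar : X → A → ℝ) (x : X) (a : Fin K → A) : Measure (Round X A K) :=
  ∑ k, ENNReal.ofReal (mnlProb (fun j => Rstar x (a j)) k) • Measure.dirac (x, a, k)

/-- The law of one round `(x, (a₁, …, a_K), y)`: `x ∼ d₀`, then `a₁, …, a_K` i.i.d. from `π(· | x)`,
then `y` from the MNL choice probabilities of the true reward `Rstar`. -/
def roundLaw (K : ℕ) (d₀ : Measure X) (π : X → Measure A) (Rstar : X → A → ℝ) :
    Measure (Round X A K) :=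
  d₀.bind fun x => (Measure.pi fun _ : Fin K => π x).bind fun a => choiceLaw Rstar x a

/-- Population loss of `R` under the true reward `Rstar`, with slates drawn from `π₀`. -/
def popLoss (K : ℕ) (d₀ : Measure X) (π₀ : Kernel X A) (Rstar R : X → A → ℝ) : ℝ :=
  ∫ z, roundLoss R z ∂(roundLaw K d₀ π₀ Rstar)

/-- The KL-tilted policy: `π(· | x)` has density
`exp (η R(x, ·)) / ∫ exp (η R(x, a')) π₀(da' | x)` with respect to `π₀(· | x)`. -/
def klTilt (π₀ : Kernel X A) (η : ℝ) (R : X → A → ℝ) (x : X) : Measure A :=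
  (π₀ x).tilted fun a => η * R x a

/-- The law of the data of the first `t` rounds of the greedy loop when the true reward is `Rstar`:
after `t` rounds with data `h`, round `t + 1` is played with the KL-tilted policy of the current
estimate `Rhat t h`. -/
def historyLaw (K : ℕ) (d₀ : Measure X) (π₀ : Kernel X A) (η : ℝ) (Rstar : X → A → ℝ)
    (Rhat : (t : ℕ) → History X A K t → X → A → ℝ) : (t : ℕ) → Measure (History X A K t)
  | 0 => Measure.dirac Fin.elim0
  | t + 1 => (historyLaw K d₀ π₀ η Rstar Rhat t).bind fun h =>
      (roundLaw K d₀ (klTilt π₀ η (Rhat t h)) Rstar).map fun z =>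
        (Fin.snoc h z : History X A K (t + 1))

/-- Expected cumulative temperature-zero regret up to horizon `T` when the true reward is
`Rstar`. -/
def cumRegret (K : ℕ) (d₀ : Measure X) (π₀ : Kernel X A) (η : ℝ) (sel : (X → A → ℝ) → X → A)
    (Rstar : X → A → ℝ) (Rhat : (t : ℕ) → History X A K t → X → A → ℝ) (T : ℕ) : ℝ :=
  ∑ t ∈ Finset.range T,
    ∫ h, oneStepRegret d₀ sel Rstar (Rhat t h) ∂(historyLaw K d₀ π₀ η Rstar Rhat t)

/-- `Rhat` is a measurable ERM rule over the class `F`, started at the zero reward: for `t ≥ 1` the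
estimate `Rhat t h` lies in `F` and minimizes the empirical risk over `F`, whenever the actions of
the data set `h` lie in the support of the reference policy (almost every data set does). -/
structure IsERMRule [TopologicalSpace A] (K : ℕ) (π₀ : Kernel X A) (F : Set (X → A → ℝ))
    (Rhat : (t : ℕ) → History X A K t → X → A → ℝ) : Prop where
  zero : ∀ h, Rhat 0 h = 0
  measurable : ∀ t, Measurable fun w : History X A K t × X × A => Rhat t w.1 w.2.1 w.2.2
  mem : ∀ t, 1 ≤ t → ∀ h, Rhat t h ∈ F
  isMin : ∀ t, 1 ≤ t → ∀ h : History X A K t,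
    (∀ s k, (h s).2.1 k ∈ (π₀ (h s).1).support) → IsMinOn (empRisk h) F (Rhat t h)

/-- Positive one-step regret within the class is at least `ε`. -/
def IsolatesRegret {P : Type*} (d₀ : Measure X) (sel : (X → A → ℝ) → X → A) (R : P → X → A → ℝ)
    (ε : ℝ) : Prop :=
  ∀ p q, oneStepRegret d₀ sel (R p) (R q) = 0 ∨ ε ≤ oneStepRegret d₀ sel (R p) (R q)

/-- Within the class, one-step regret at least `ε` forces excess population loss at least `γ`. -/
def HasLossGap {P : Type*} (K : ℕ) (d₀ : Measure X) (π₀ : Kernel X A) (sel : (X → A → ℝ) → X → A)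
    (R : P → X → A → ℝ) (ε γ : ℝ) : Prop :=
  ∀ p q, ε ≤ oneStepRegret d₀ sel (R p) (R q) →
    γ ≤ popLoss K d₀ π₀ (R p) (R q) - popLoss K d₀ π₀ (R p) (R p)

end Loop

/-! ### The laws above are well defined (all maps bound along are measurable, total mass is one) -/

section WellDefined

variable {X A : Type*} [MeasurableSpace X] [MeasurableSpace A]

lemma measurable_bind_dep {α β γ : Type*} [MeasurableSpace α] [MeasurableSpace β] [MeasurableSpace γ]
    {m : α → Measure β} {f : α → β → Measure γ} (hm : Measurable m)
    (hp : ∀ a, IsProbabilityMeasure (m a))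
    (hf : Measurable fun z : α × β => f z.1 z.2) :
    Measurable fun a => (m a).bind (f a) := by
  refine Measure.measurable_of_measurable_coe _ fun s hs => ?_
  let κ : Kernel α β := ⟨m, hm⟩
  have : IsMarkovKernel κ := ⟨hp⟩
  have h1 : ∀ a, (m a).bind (f a) s = ∫⁻ b, f a b s ∂(κ a) := fun a =>
    Measure.bind_apply hs (hf.comp measurable_prodMk_left).aemeasurable
  simp_rw [h1]
  exact Measurable.lintegral_kernel_prod_right ((Measure.measurable_coe hs).comp hf)

lemma isProbabilityMeasure_bind_dep {β γ : Type*} [MeasurableSpace β] [MeasurableSpace γ]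
    {m : Measure β} {f : β → Measure γ} (hp : IsProbabilityMeasure m) (hf : Measurable f)
    (hq : ∀ b, IsProbabilityMeasure (f b)) : IsProbabilityMeasure (m.bind f) := by
  constructor
  rw [Measure.bind_apply .univ hf.aemeasurable]; simp

lemma measurable_pi_const {α : Type*} [MeasurableSpace α] {m : α → Measure A} (hm : Measurable m)
    (hp : ∀ a, IsProbabilityMeasure (m a)) (K : ℕ) :
    Measurable fun a => Measure.pi fun _ : Fin K => m a := by
  refine Measurable.measure_of_isPiSystem_of_isProbabilityMeasure generateFrom_pi.symm isPiSystem_pi ?_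
  rintro _ ⟨s, hs, rfl⟩
  simp only [Measure.pi_pi]
  exact Finset.measurable_prod _ fun i _ => (Measure.measurable_coe (hs i (Set.mem_univ i))).comp hm

lemma measurable_klTilt {H : Type*} [MeasurableSpace H] (π₀ : Kernel X A) [IsMarkovKernel π₀] (η : ℝ)
    (R : H → X → A → ℝ) (hR : Measurable fun w : H × X × A => R w.1 w.2.1 w.2.2) :
    Measurable fun w : H × X => klTilt π₀ η (R w.1) w.2 := by
  refine Measure.measurable_of_measurable_coe _ fun s hs => ?_
  let κ : Kernel (H × X) A := π₀.comap Prod.snd measurable_snd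
  have hE : Measurable fun z : (H × X) × A => Real.exp (η * R z.1.1 z.1.2 z.2) :=
    Real.measurable_exp.comp ((hR.comp (by fun_prop : Measurable fun z : (H × X) × A => (z.1.1, z.1.2, z.2))).const_mul η)
  have hZ : Measurable fun w : H × X => ∫ a, Real.exp (η * R w.1 w.2 a) ∂(κ w) :=
    (StronglyMeasurable.integral_kernel_prod_right' (κ := κ) hE.stronglyMeasurable).measurable
  have h1 : ∀ w : H × X, klTilt π₀ η (R w.1) w.2 s = ∫⁻ a, s.indicator (fun a => ENNReal.ofReal
      (Real.exp (η * R w.1 w.2 a) / ∫ a, Real.exp (η * R w.1 w.2 a) ∂(κ w))) a ∂(κ w) := by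
    intro w
    rw [klTilt, Measure.tilted, withDensity_apply _ hs, lintegral_indicator hs]; rfl
  simp_rw [h1]
  refine Measurable.lintegral_kernel_prod_right ?_
  have := (ENNReal.measurable_ofReal.comp (hE.div (hZ.comp measurable_fst))).indicator (hs.preimage measurable_snd)
  convert this using 1
  funext z
  by_cases hz : z.2 ∈ s <;> simp [Function.uncurry, hz]

lemma measurable_choiceLaw (K : ℕ) (Rs : X → A → ℝ) (h : Measurable fun z : X × A => Rs z.1 z.2) :
    Measurable fun z : X × (Fin K → A) => choiceLaw Rs z.1 z.2 := by
  unfold choiceLaw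
  refine Measure.measurable_of_measurable_coe _ fun s hs => ?_
  simp only [Measure.finsetSum_apply, Measure.smul_apply, smul_eq_mul]
  refine Finset.measurable_sum _ fun k _ => Measurable.mul ?_ ?_
  · have : ∀ j, Measurable fun z : X × (Fin K → A) => Rs z.1 (z.2 j) := fun j =>
      h.comp (by fun_prop : Measurable fun z : X × (Fin K → A) => (z.1, z.2 j))
    unfold mnlProb
    fun_prop
  · exact (Measure.measurable_coe hs).comp (Measure.measurable_dirac.comp (by fun_prop))

lemma isProbabilityMeasure_choiceLaw {K : ℕ} (hK : 0 < K) (Rs : X → A → ℝ) (x : X) (a : Fin K → A) :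
    IsProbabilityMeasure (choiceLaw Rs x a) := by
  unfold choiceLaw
  generalize (fun j => Rs x (a j)) = v
  constructor
  have : Nonempty (Fin K) := ⟨⟨0, hK⟩⟩
  have hp : 0 < ∑ l, Real.exp (v l) := Finset.sum_pos (fun _ _ => Real.exp_pos _) Finset.univ_nonempty
  simp only [Measure.finsetSum_apply, Measure.smul_apply, smul_eq_mul, measure_univ, mul_one]
  rw [← ENNReal.ofReal_sum_of_nonneg (fun k _ => by unfold mnlProb; positivity)]
  simp only [mnlProb, ← Finset.sum_div, div_self hp.ne', ENNReal.ofReal_one]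

lemma isProbabilityMeasure_roundLaw {K : ℕ} (hK : 0 < K) (d₀ : Measure X) [IsProbabilityMeasure d₀] (π : X → Measure A)
    (hπ : Measurable π) (hp : ∀ x, IsProbabilityMeasure (π x)) (Rs : X → A → ℝ)
    (h : Measurable fun z : X × A => Rs z.1 z.2) : IsProbabilityMeasure (roundLaw K d₀ π Rs) := by
  unfold roundLaw
  have h2 : ∀ x, IsProbabilityMeasure (Measure.pi fun _ : Fin K => π x) := fun x => inferInstance
  have h3 := measurable_bind_dep (f := fun x (a : Fin K → A) => choiceLaw Rs x a) (measurable_pi_const hπ hp K) h2 (measurable_choiceLaw K Rs h)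
  have h5 : ∀ x, Measurable fun a : Fin K → A => choiceLaw Rs x a := fun x =>
    (measurable_choiceLaw K Rs h).comp (g := fun z : X × (Fin K → A) => choiceLaw Rs z.1 z.2) (f := Prod.mk x) measurable_prodMk_left
  have h6 : ∀ x, IsProbabilityMeasure ((Measure.pi fun _ : Fin K => π x).bind fun a => choiceLaw Rs x a) :=
    fun x => isProbabilityMeasure_bind_dep (h2 x) (h5 x) (fun a => isProbabilityMeasure_choiceLaw hK Rs x a)
  exact isProbabilityMeasure_bind_dep inferInstance h3 h6

lemma isProbabilityMeasure_historyLaw {K : ℕ} (hK : 0 < K) (d₀ : Measure X) [IsProbabilityMeasure d₀]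
    (π₀ : Kernel X A) [IsMarkovKernel π₀] (η : ℝ) (Rs : X → A → ℝ)
    (h : Measurable fun z : X × A => Rs z.1 z.2)
    (Rhat : (t : ℕ) → History X A K t → X → A → ℝ)
    (hR : ∀ t, Measurable fun w : History X A K t × X × A => Rhat t w.1 w.2.1 w.2.2)
    (hi : ∀ t h x, Integrable (fun a => Real.exp (η * Rhat t h x a)) (π₀ x)) (t : ℕ) :
    IsProbabilityMeasure (historyLaw K d₀ π₀ η Rs Rhat t) := by
  have hp : ∀ t h x, IsProbabilityMeasure (klTilt π₀ η (Rhat t h) x) := fun t h x =>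
    isProbabilityMeasure_tilted (hi t h x)
  induction t with
  | zero => unfold historyLaw; infer_instance
  | succ t ih =>
    have hT := measurable_klTilt π₀ η (Rhat t) (hR t)
    have hs : Measurable fun w : History X A K t × Round X A K =>
        (Fin.snoc w.1 w.2 : History X A K (t+1)) := by
      refine measurable_pi_lambda _ fun i => ?_
      refine Fin.lastCases ?_ (fun j => ?_) i
      · simpa using measurable_snd
      · simp only [Fin.snoc_castSucc]; exact (measurable_pi_apply j).comp measurable_fst
    have hrp : ∀ h : History X A K t, IsProbabilityMeasure (roundLaw K d₀ (klTilt π₀ η (Rhat t h)) Rs) := fun h' =>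
      isProbabilityMeasure_roundLaw hK d₀ _ (hT.comp measurable_prodMk_left) (hp t h') Rs h
    have hr : Measurable fun h : History X A K t => roundLaw K d₀ (klTilt π₀ η (Rhat t h)) Rs := by
      unfold roundLaw
      have h2 : ∀ w : History X A K t × X, IsProbabilityMeasure (Measure.pi fun _ : Fin K => klTilt π₀ η (Rhat t w.1) w.2) := fun w => by
        have := hp t w.1 w.2; infer_instance
      have h4 := (measurable_choiceLaw K Rs h).comp (by fun_prop : Measurable fun z : (History X A K t × X) × (Fin K → A) => (z.1.2, z.2))
      have h3 := measurable_bind_dep (f := fun (w : History X A K t × X) (a : Fin K → A) => choiceLaw Rs w.2 a) (measurable_pi_const hT (fun w => hp t w.1 w.2) K) h2 h4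
      exact measurable_bind_dep (m := fun _ : History X A K t => d₀) (f := fun h' x => (Measure.pi fun _ : Fin K => klTilt π₀ η (Rhat t h') x).bind fun a => choiceLaw Rs x a) measurable_const (fun _ => inferInstance) h3
    unfold historyLaw
    refine isProbabilityMeasure_bind_dep ih ?_ fun h' => ?_
    · refine Measure.measurable_of_measurable_coe _ fun s hs' => ?_
      have : ∀ h' : History X A K t, ((roundLaw K d₀ (klTilt π₀ η (Rhat t h')) Rs).map fun z =>
        (Fin.snoc h' z : History X A K (t + 1))) s = (roundLaw K d₀ (klTilt π₀ η (Rhat t h')) Rs) (Prod.mk h' ⁻¹' ((fun w : History X A K t × Round X A K =>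
        (Fin.snoc w.1 w.2 : History X A K (t+1))) ⁻¹' s)) := fun h' => by
          exact Measure.map_apply (f := fun z => (Fin.snoc h' z : History X A K (t + 1))) (hs.comp measurable_prodMk_left) hs'
      simp_rw [this]
      let κ : Kernel (History X A K t) (Round X A K) := ⟨_, hr⟩
      have : IsMarkovKernel κ := ⟨hrp⟩
      exact Kernel.measurable_kernel_prodMk_left (κ := κ) (hs hs')
    · have := hrp h'
      exact Measure.isProbabilityMeasure_map (hs.comp measurable_prodMk_left).aemeasurable
end WellDefined

end

end GreedyRLHF

open GreedyRLHF

/-!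
The regret of the greedy loop is bounded because, within the class, "positive regret" is separated
from "zero regret" and positive regret is exponentially unlikely.

*Separation.* The reward gap makes the maximizer locally constant: two rewards that are closer than
the gap on the support have almost surely the same selector (`ae_sel_eq_of_close`). By compactness
there are, up to null sets, finitely many selectors, so regrets within the class are zero or bounded
below (`exists_isolatesRegret`). The excess population loss is the expected Kullback–Leibler
divergence of the choice laws (`popLoss_sub_popLoss`); it vanishes only if the rewards differ by a
constant on almost every slate, and centering and continuity then force equality on the support
(`ae_sel_eq_of_integral_mnlKL_eq_zero`). A compactness argument turns this into a uniform loss gap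
(`exists_hasLossGap`).

*Concentration.* The tilted policies dominate a fixed fraction `exp (-2 η B)` of the reference
policy (`smul_le_klTilt`), so whatever the past, the excess loss of a reward with large excess
population loss has a conditional mean bounded below in every round. An exponential moment bound, multiplied up
along the rounds, shows that its empirical excess loss is small only with exponentially small
probability (`historyLaw_sum_excessLoss_le`). Positive regret of the empirical risk minimizer forces
this event for one of the centers of a finite net (`IsERMRule.exists_center`), so a union bound
gives an exponentially decaying expected regret (`IsERMRule.integral_oneStepRegret_le`), which is
summable (`sum_le_of_exponential_tail`).

Measurability in the data of the regret of the estimate is not automatic, as selectors are chosen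
reward by reward; it follows from the finiteness of the set of selectors
(`IsERMRule.measurable_oneStepRegret`).
-/

namespace GreedyRLHF

set_option linter.unusedSectionVars false

/-! ### The multinomial logit model -/

lemma sum_exp_pos {K : ℕ} (hK : 0 < K) (v : Fin K → ℝ) : 0 < ∑ l, Real.exp (v l) :=
  haveI : Nonempty (Fin K) := ⟨⟨0, hK⟩⟩
  Finset.sum_pos (fun _ _ => Real.exp_pos _) Finset.univ_nonempty

lemma mnlProb_pos {K : ℕ} (v : Fin K → ℝ) (k : Fin K) : 0 < mnlProb v k :=
  div_pos (Real.exp_pos _) (sum_exp_pos k.pos v)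

lemma mnlProb_nonneg {K : ℕ} (v : Fin K → ℝ) (k : Fin K) : 0 ≤ mnlProb v k :=
  (mnlProb_pos v k).le

lemma sum_mnlProb {K : ℕ} (hK : 0 < K) (v : Fin K → ℝ) : ∑ k, mnlProb v k = 1 := by
  simp only [mnlProb, ← Finset.sum_div, div_self (sum_exp_pos hK v).ne']

lemma mnlLoss_eq_neg_log {K : ℕ} (v : Fin K → ℝ) (k : Fin K) :
    mnlLoss v k = -Real.log (mnlProb v k) := by
  rw [mnlLoss, mnlProb, Real.log_div (Real.exp_pos _).ne' (sum_exp_pos k.pos v).ne', Real.log_exp]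
  ring

lemma mnlLoss_nonneg {K : ℕ} (v : Fin K → ℝ) (k : Fin K) : 0 ≤ mnlLoss v k := by
  rw [mnlLoss_eq_neg_log, neg_nonneg]
  refine Real.log_nonpos (mnlProb_nonneg v k) ?_
  rw [← sum_mnlProb k.pos v]
  exact Finset.single_le_sum (fun i _ => mnlProb_nonneg v i) (Finset.mem_univ k)

lemma mnlLoss_le {K : ℕ} {v : Fin K → ℝ} {B : ℝ} (hv : ∀ k, |v k| ≤ B) (y : Fin K) :
    mnlLoss v y ≤ Real.log K + 2 * B := by
  have hK : (0 : ℝ) < K := by exact_mod_cast y.pos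
  have h : Real.log (∑ k, Real.exp (v k)) ≤ Real.log K + B := by
    rw [← Real.log_exp B, ← Real.log_mul hK.ne' (Real.exp_pos _).ne']
    refine Real.log_le_log (sum_exp_pos y.pos v) ?_
    calc ∑ k, Real.exp (v k) ≤ ∑ _k : Fin K, Real.exp B :=
          Finset.sum_le_sum fun k _ => Real.exp_le_exp.2 (abs_le.1 (hv k)).2
      _ = _ := by simp
  have := (abs_le.1 (hv y)).1
  rw [mnlLoss]; linarith

/-- The log-loss is `2`-Lipschitz for the supremum norm: both the log-sum-exp function and the
coordinate are `1`-Lipschitz. -/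
lemma mnlLoss_le_add {K : ℕ} {v w : Fin K → ℝ} {δ : ℝ} (h : ∀ k, |v k - w k| ≤ δ) (y : Fin K) :
    mnlLoss v y ≤ mnlLoss w y + 2 * δ := by
  have h1 : Real.log (∑ k, Real.exp (v k)) ≤ Real.log (∑ k, Real.exp (w k)) + δ := by
    rw [← Real.log_exp δ, ← Real.log_mul (sum_exp_pos y.pos w).ne' (Real.exp_pos _).ne',
      Finset.sum_mul]
    refine Real.log_le_log (sum_exp_pos y.pos v) (Finset.sum_le_sum fun k _ => ?_)
    rw [← Real.exp_add, Real.exp_le_exp]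
    linarith [(abs_le.1 (h k)).2]
  have := (abs_le.1 (h y)).1
  rw [mnlLoss, mnlLoss]; linarith

/-- The Kullback–Leibler divergence between the MNL choice laws of the reward vectors `v` (the
truth) and `w`. -/
noncomputable def mnlKL {K : ℕ} (v w : Fin K → ℝ) : ℝ :=
  ∑ k, mnlProb v k * (mnlLoss w k - mnlLoss v k)

lemma sub_le_mul_mnlLoss_sub {K : ℕ} (v w : Fin K → ℝ) (k : Fin K) :
    mnlProb v k - mnlProb w k ≤ mnlProb v k * (mnlLoss w k - mnlLoss v k) := by
  have hp := mnlProb_pos v k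
  have hq := mnlProb_pos w k
  have h := Real.log_le_sub_one_of_pos (div_pos hq hp)
  rw [Real.log_div hq.ne' hp.ne'] at h
  rw [mnlLoss_eq_neg_log, mnlLoss_eq_neg_log]
  have h2 : mnlProb v k * (mnlProb w k / mnlProb v k) = mnlProb w k := by field_simp
  nlinarith

lemma mnlKL_nonneg {K : ℕ} (v w : Fin K → ℝ) : 0 ≤ mnlKL v w := by
  rcases K.eq_zero_or_pos with rfl | hK
  · simp [mnlKL]
  · have := Finset.sum_le_sum fun k (_ : k ∈ Finset.univ) => sub_le_mul_mnlLoss_sub v w k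
    rwa [Finset.sum_sub_distrib, sum_mnlProb hK, sum_mnlProb hK, sub_self] at this

/-- A vanishing divergence forces the choice laws to agree, hence the reward vectors to agree up to
an additive constant. -/
lemma sub_eq_sub_of_mnlKL_eq_zero {K : ℕ} {v w : Fin K → ℝ} (h : mnlKL v w = 0) (i j : Fin K) :
    v i - w i = v j - w j := by
  have hs : ∑ k, (mnlProb v k * (mnlLoss w k - mnlLoss v k) - (mnlProb v k - mnlProb w k)) = 0 := by
    rw [Finset.sum_sub_distrib, Finset.sum_sub_distrib, sum_mnlProb i.pos, sum_mnlProb i.pos]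
    simpa [mnlKL] using h
  have h0 := (Finset.sum_eq_zero_iff_of_nonneg fun k _ =>
    sub_nonneg.2 (sub_le_mul_mnlLoss_sub v w k)).1 hs
  have key : ∀ k, mnlProb v k = mnlProb w k := fun k => by
    have hk := h0 k (Finset.mem_univ k)
    have hp := mnlProb_pos v k
    have hq := mnlProb_pos w k
    by_contra hne
    have hlt := Real.log_lt_sub_one_of_pos (div_pos hq hp)
      (fun h1 => hne ((div_eq_one_iff_eq hp.ne').1 h1).symm)
    rw [Real.log_div hq.ne' hp.ne'] at hlt
    rw [mnlLoss_eq_neg_log, mnlLoss_eq_neg_log] at hk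
    have h2 : mnlProb v k * (mnlProb w k / mnlProb v k) = mnlProb w k := by field_simp
    nlinarith
  have hl : ∀ k, mnlLoss v k = mnlLoss w k := fun k => by
    rw [mnlLoss_eq_neg_log, mnlLoss_eq_neg_log, key]
  have hi := hl i
  have hj := hl j
  simp only [mnlLoss] at hi hj
  linarith

lemma mnlKL_le {K : ℕ} {v w : Fin K → ℝ} {B : ℝ} (hK : 0 < K) (hw : ∀ k, |w k| ≤ B) :
    mnlKL v w ≤ Real.log K + 2 * B := by
  calc mnlKL v w ≤ ∑ k, mnlProb v k * (Real.log K + 2 * B) :=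
        Finset.sum_le_sum fun k _ => mul_le_mul_of_nonneg_left
          (by linarith [mnlLoss_le hw k, mnlLoss_nonneg v k]) (mnlProb_nonneg v k)
    _ = _ := by rw [← Finset.sum_mul, sum_mnlProb hK, one_mul]

lemma mnlKL_le_add {K : ℕ} {v w w' : Fin K → ℝ} {δ : ℝ} (hK : 0 < K)
    (h : ∀ k, |w k - w' k| ≤ δ) : mnlKL v w ≤ mnlKL v w' + 2 * δ := by
  calc mnlKL v w ≤ ∑ k, (mnlProb v k * (mnlLoss w' k - mnlLoss v k) + mnlProb v k * (2 * δ)) :=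
        Finset.sum_le_sum fun k _ => by
          rw [← mul_add]
          exact mul_le_mul_of_nonneg_left (by linarith [mnlLoss_le_add h k]) (mnlProb_nonneg v k)
    _ = _ := by rw [Finset.sum_add_distrib, ← Finset.sum_mul, sum_mnlProb hK, one_mul, mnlKL]

lemma exp_neg_le_quadratic {x : ℝ} (hx : |x| ≤ 1) : Real.exp (-x) ≤ 1 - x + x ^ 2 := by
  have := Real.abs_exp_sub_one_sub_id_le (x := -x) (by rwa [abs_neg])
  have := (abs_le.1 this).2
  linarith [neg_sq x]

/-- Second-order bound for the moment generating function of the excess loss. -/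
lemma sum_mnlProb_mul_exp_le {K : ℕ} {v w : Fin K → ℝ} {M s : ℝ} (hK : 0 < K)
    (hM : ∀ k, |mnlLoss w k - mnlLoss v k| ≤ M) (hs : 0 ≤ s) (hsM : s * M ≤ 1) :
    ∑ k, mnlProb v k * Real.exp (-(s * (mnlLoss w k - mnlLoss v k))) + s * mnlKL v w
      ≤ 1 + (s * M) ^ 2 := by
  have h : ∀ k, mnlProb v k * Real.exp (-(s * (mnlLoss w k - mnlLoss v k))) ≤
      mnlProb v k * (1 + (s * M) ^ 2)
        - s * (mnlProb v k * (mnlLoss w k - mnlLoss v k)) := fun k => by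
    have h1 : |s * (mnlLoss w k - mnlLoss v k)| ≤ s * M := by
      rw [abs_mul, abs_of_nonneg hs]; exact mul_le_mul_of_nonneg_left (hM k) hs
    have h2 := exp_neg_le_quadratic (h1.trans hsM)
    have h3 : (s * (mnlLoss w k - mnlLoss v k)) ^ 2 ≤ (s * M) ^ 2 := sq_le_sq' (by
      linarith [(abs_le.1 h1).1]) (abs_le.1 h1).2
    calc _ ≤ mnlProb v k * (1 - s * (mnlLoss w k - mnlLoss v k) + (s * M) ^ 2) :=
          mul_le_mul_of_nonneg_left (by linarith) (mnlProb_nonneg v k)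
      _ = _ := by ring
  have := Finset.sum_le_sum fun k (_ : k ∈ Finset.univ) => h k
  rw [Finset.sum_sub_distrib, ← Finset.sum_mul, sum_mnlProb hK, ← Finset.mul_sum] at this
  rw [mnlKL]; linarith

@[fun_prop]
lemma continuous_mnlProb {K : ℕ} (k : Fin K) : Continuous fun v : Fin K → ℝ => mnlProb v k := by
  unfold mnlProb
  exact Continuous.div (by fun_prop) (by fun_prop) fun v => (sum_exp_pos k.pos v).ne'

@[fun_prop]
lemma continuous_mnlLoss {K : ℕ} (k : Fin K) : Continuous fun v : Fin K → ℝ => mnlLoss v k := by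
  unfold mnlLoss
  exact (Continuous.log (by fun_prop) fun v => (sum_exp_pos k.pos v).ne').sub (by fun_prop)

lemma continuous_mnlKL {K : ℕ} :
    Continuous fun z : (Fin K → ℝ) × (Fin K → ℝ) => mnlKL z.1 z.2 := by
  unfold mnlKL
  refine continuous_finsetSum _ fun k _ => ?_
  exact ((continuous_mnlProb k).comp continuous_fst).mul
    (((continuous_mnlLoss k).comp continuous_snd).sub ((continuous_mnlLoss k).comp continuous_fst))

lemma tendsto_mnlKL {K : ℕ} {ι : Type*} {l : Filter ι} {v w : ι → Fin K → ℝ} {v₀ w₀ : Fin K → ℝ}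
    (hv : Filter.Tendsto v l (nhds v₀)) (hw : Filter.Tendsto w l (nhds w₀)) :
    Filter.Tendsto (fun n => mnlKL (v n) (w n)) l (nhds (mnlKL v₀ w₀)) := by
  have h := (continuous_mnlKL.tendsto (v₀, w₀)).comp (hv.prodMk_nhds hw)
  exact h

/-! ### The support graph and the reward class -/

section RewardClass

variable {X A P : Type*} [MeasurableSpace X] [MetricSpace A] [SecondCountableTopology A]
  [MeasurableSpace A] [BorelSpace A] {d₀ : Measure X} {π₀ : Kernel X A} {R : P → X → A → ℝ}

lemma measurableSet_suppGraph : MeasurableSet (suppGraph π₀) := by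
  have hb := TopologicalSpace.isBasis_countableBasis A
  have : suppGraph π₀ = ⋂ U ∈ TopologicalSpace.countableBasis A,
      {z : X × A | z.2 ∈ U → 0 < π₀ z.1 U} := by
    ext z
    simp only [suppGraph, Set.mem_ofPred_eq, Set.mem_iInter]
    rw [hb.nhds_hasBasis.mem_measureSupport]
    exact ⟨fun h U hU hz => h U ⟨hU, hz⟩, fun h U hU => h U hU.1 hU.2⟩
  rw [this]
  refine MeasurableSet.biInter (TopologicalSpace.countable_countableBasis A) fun U hU => ?_
  have hUm : MeasurableSet U := (hb.isOpen hU).measurableSet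
  have h1 : MeasurableSet {z : X × A | z.2 ∈ U} := measurable_snd hUm
  have h2 : MeasurableSet {z : X × A | 0 < π₀ z.1 U} :=
    measurableSet_lt measurable_const ((Kernel.measurable_coe π₀ hUm).comp measurable_fst)
  exact h1.imp h2

lemma le_on_support_of_ae_le {μ : Measure A} {f : A → ℝ} {c : ℝ}
    (hf : ContinuousOn f μ.support) (h : ∀ᵐ a ∂μ, f a ≤ c) : ∀ a ∈ μ.support, f a ≤ c := by
  have hcl := hf.preimage_isClosed_of_isClosed Measure.isClosed_support (isClosed_Iic (a := c))
  have hmem : μ.support ∩ f ⁻¹' Set.Iic c ∈ ae μ := by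
    filter_upwards [h, Measure.support_mem_ae] with a h1 h2 using ⟨h2, h1⟩
  exact fun a ha => (Measure.support_subset_of_isClosed hcl hmem ha).2

lemma edist_onSupport_le_iff {f g : X → A → ℝ} {δ : ℝ} (hδ : 0 ≤ δ) :
    edist (onSupport π₀ f) (onSupport π₀ g) ≤ ENNReal.ofReal δ ↔
      ∀ z ∈ suppGraph π₀, |f z.1 z.2 - g z.1 z.2| ≤ δ := by
  rw [UniformFun.edist_le]
  simp [onSupport, edist_dist, Real.dist_eq, ENNReal.ofReal_le_ofReal_iff hδ]

/-- At every scale the class has a finite net of members, of cardinality at most the covering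
number. -/
lemma exists_finset_net (hcpt : IsCompact (classOnSupport π₀ R)) {δ : ℝ} (hδ : 0 < δ) :
    Metric.coveringNumber δ.toNNReal (classOnSupport π₀ R) ≠ ⊤ ∧
    ∃ I : Finset P, (I.card : ℕ∞) ≤ Metric.coveringNumber δ.toNNReal (classOnSupport π₀ R) ∧
      ∀ p, ∃ i ∈ I, ∀ z ∈ suppGraph π₀, |R p z.1 z.2 - R i z.1 z.2| ≤ δ := by
  classical
  have hne : Metric.coveringNumber δ.toNNReal (classOnSupport π₀ R) ≠ ⊤ := by
    obtain ⟨N, hN, hfin, hcov⟩ := Metric.exists_finite_isCover_of_isCompact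
      (ε := δ.toNNReal) (by simpa using hδ) hcpt
    exact ((hcov.coveringNumber_le_encard hN).trans_lt hfin.encard_lt_top).ne
  refine ⟨hne, ?_⟩
  rcases isEmpty_or_nonempty P with hP | hP
  · exact ⟨∅, by simp, fun p => hP.elim p⟩
  obtain ⟨C, hC, hfin, hcov, hcard⟩ := Metric.exists_set_encard_eq_coveringNumber hne
  have hC' : ∀ c ∈ C, ∃ p, onSupport π₀ (R p) = c := fun c hc => hC hc
  choose! idx hidx using hC'
  refine ⟨hfin.toFinset.image idx, ?_, fun p => ?_⟩
  · rw [← hcard, hfin.encard_eq_coe_toFinset_card]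
    exact_mod_cast Finset.card_image_le
  · obtain ⟨c, hc, hd⟩ := hcov (Set.mem_range_self p)
    refine ⟨idx c, Finset.mem_image_of_mem _ (hfin.mem_toFinset.2 hc), ?_⟩
    rw [← edist_onSupport_le_iff hδ.le]
    have h2 : onSupport π₀ (R (idx c)) = c := hidx c hc
    rw [h2]
    exact hd

lemma CompactContinuous.bddAbove (h : CompactContinuous d₀ π₀ R) :
    BddAbove (Set.range fun q : P × suppGraph π₀ => |R q.1 q.2.1.1 q.2.1.2|) := by
  obtain ⟨-, I, -, hI⟩ := exists_finset_net h.compact one_pos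
  choose C hC using h.bounded
  refine ⟨∑ i ∈ I, |C i| + 1, ?_⟩
  rintro _ ⟨⟨p, z, hz⟩, rfl⟩
  obtain ⟨i, hi, hpi⟩ := hI p
  have h1 := hpi z hz
  have h2 := hC i z hz
  have h3 : |C i| ≤ ∑ i ∈ I, |C i| :=
    Finset.single_le_sum (f := fun i => |C i|) (fun _ _ => abs_nonneg _) hi
  have h4 := abs_sub_abs_le_abs_sub (R p z.1 z.2) (R i z.1 z.2)
  have h5 := le_abs_self (C i)
  change |R p z.1 z.2| ≤ _
  linarith

lemma CompactContinuous.abs_le_envelope (h : CompactContinuous d₀ π₀ R) (p : P) {x : X} {a : A}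
    (ha : a ∈ (π₀ x).support) : |R p x a| ≤ envelope π₀ R :=
  le_ciSup h.bddAbove (⟨p, ⟨(x, a), ha⟩⟩ : P × suppGraph π₀)

lemma envelope_nonneg : 0 ≤ envelope π₀ R := Real.iSup_nonneg fun _ => abs_nonneg _

/-! ### Selectors and regret gaps -/

variable {sel : (X → A → ℝ) → X → A}

lemma IsArgmaxSelector.sub_le_deltaMax (hsel : IsArgmaxSelector π₀ (insert 0 (Set.range R)) sel)
    (h : CompactContinuous d₀ π₀ R) (p : P) {x : X} {a : A} (ha : a ∈ (π₀ x).support) :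
    R p x (sel (R p) x) - R p x a ≤ deltaMax π₀ sel R := by
  refine le_ciSup (f := fun q : P × suppGraph π₀ =>
    R q.1 q.2.1.1 (sel (R q.1) q.2.1.1) - R q.1 q.2.1.1 q.2.1.2) ?_
    (⟨p, ⟨(x, a), ha⟩⟩ : P × suppGraph π₀)
  refine ⟨2 * envelope π₀ R, ?_⟩
  rintro _ ⟨⟨q, z, hz⟩, rfl⟩
  have h1 := (abs_le.1 (h.abs_le_envelope q ((hsel (R q) (by simp)).2 z.1).1)).2
  have h2 := (abs_le.1 (h.abs_le_envelope q hz)).1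
  change R q z.1 (sel (R q) z.1) - R q z.1 z.2 ≤ _
  linarith

lemma IsArgmaxSelector.mem_support {F : Set (X → A → ℝ)} (hsel : IsArgmaxSelector π₀ F sel)
    {f : X → A → ℝ} (hf : f ∈ F) (x : X) : sel f x ∈ (π₀ x).support :=
  ((hsel f hf).2 x).1

lemma IsArgmaxSelector.le {F : Set (X → A → ℝ)} (hsel : IsArgmaxSelector π₀ F sel)
    {f : X → A → ℝ} (hf : f ∈ F) {x : X} {a : A} (ha : a ∈ (π₀ x).support) :
    f x a ≤ f x (sel f x) :=
  ((hsel f hf).2 x).2 a ha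

/-- With a reward gap, rewards closer than the gap on the support have the same maximizers: at two
different maximizers both gaps would have to be bridged. -/
lemma ae_sel_eq_of_close (hsel : IsArgmaxSelector π₀ (insert 0 (Set.range R)) sel) {Δ : ℝ}
    (hgap : ∀ p, ∀ᵐ x ∂d₀, ∀ a ∈ (π₀ x).support, a ≠ sel (R p) x →
      R p x a + Δ ≤ R p x (sel (R p) x)) {p q : P}
    (hpq : ∀ z ∈ suppGraph π₀, |R p z.1 z.2 - R q z.1 z.2| < Δ) :
    sel (R p) =ᵐ[d₀] sel (R q) := by
  filter_upwards [hgap p, hgap q] with x hp hq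
  by_contra hne
  have mp := hsel.mem_support (f := R p) (by simp) x
  have mq := hsel.mem_support (f := R q) (by simp) x
  have h1 := hp _ mq (Ne.symm hne)
  have h2 := hq _ mp hne
  have h3 := (abs_lt.1 (hpq (x, _) mp)).2
  have h4 := (abs_lt.1 (hpq (x, _) mq)).1
  simp only at h3 h4
  linarith

/-- A selector of another member that maximizes `R q` among almost all actions is the selector of
`R q`: by continuity it maximizes over the whole support, where the maximizer is unique. -/
lemma ae_sel_eq_of_ae_le (hsel : IsArgmaxSelector π₀ (insert 0 (Set.range R)) sel)
    (hC1 : CompactContinuous d₀ π₀ R) (hC2 : HasRewardGap d₀ π₀ sel R) {p q : P}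
    (h : ∀ᵐ x ∂d₀, ∀ᵐ a ∂(π₀ x), R q x a ≤ R q x (sel (R p) x)) :
    sel (R p) =ᵐ[d₀] sel (R q) := by
  obtain ⟨Δ, hΔ, hgap⟩ := hC2
  filter_upwards [hgap q, h, hC1.continuous q] with x hq hx hcont
  by_contra hne
  have h1 := hq _ (hsel.mem_support (f := R p) (by simp) x) hne
  have h2 := le_on_support_of_ae_le hcont hx _ (hsel.mem_support (f := R q) (by simp) x)
  linarith

lemma oneStepRegret_congr {f g g' : X → A → ℝ} (h : sel g =ᵐ[d₀] sel g') :
    oneStepRegret d₀ sel f g = oneStepRegret d₀ sel f g' :=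
  integral_congr_ae <| by filter_upwards [h] with x hx; rw [hx]

lemma oneStepRegret_eq_zero {f g : X → A → ℝ} (h : sel f =ᵐ[d₀] sel g) :
    oneStepRegret d₀ sel f g = 0 := by
  rw [← oneStepRegret_congr h, oneStepRegret]; simp

lemma integrable_regret [IsFiniteMeasure d₀] (hRmeas : ∀ p, Measurable fun z : X × A => R p z.1 z.2)
    (hsel : IsArgmaxSelector π₀ (insert 0 (Set.range R)) sel)
    (hC1 : CompactContinuous d₀ π₀ R) (p : P) {g : X → A → ℝ} (hg : g ∈ insert 0 (Set.range R)) :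
    Integrable (fun x => R p x (sel (R p) x) - R p x (sel g x)) d₀ := by
  have hm : ∀ f ∈ insert 0 (Set.range R), Measurable fun x => R p x (sel f x) := fun f hf =>
    (hRmeas p).comp (measurable_id.prodMk (hsel f hf).1)
  refine Integrable.of_bound ((hm _ (by simp)).sub (hm g hg)).aestronglyMeasurable
    (2 * envelope π₀ R) (Filter.Eventually.of_forall fun x => ?_)
  have h1 := hC1.abs_le_envelope p (hsel.mem_support (f := R p) (by simp) x)
  have h2 := hC1.abs_le_envelope p (hsel.mem_support hg x)
  exact (abs_sub _ _).trans (by linarith)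

lemma oneStepRegret_nonneg (hsel : IsArgmaxSelector π₀ (insert 0 (Set.range R)) sel) (p : P)
    {g : X → A → ℝ} (hg : g ∈ insert 0 (Set.range R)) : 0 ≤ oneStepRegret d₀ sel (R p) g :=
  integral_nonneg fun x => sub_nonneg.2 (hsel.le (by simp) (hsel.mem_support hg x))

lemma oneStepRegret_le_deltaMax [IsProbabilityMeasure d₀]
    (hRmeas : ∀ p, Measurable fun z : X × A => R p z.1 z.2)
    (hsel : IsArgmaxSelector π₀ (insert 0 (Set.range R)) sel)
    (hC1 : CompactContinuous d₀ π₀ R) (p : P) {g : X → A → ℝ} (hg : g ∈ insert 0 (Set.range R)) :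
    oneStepRegret d₀ sel (R p) g ≤ deltaMax π₀ sel R := by
  have := integral_mono (integrable_regret hRmeas hsel hC1 p hg)
    (integrable_const (deltaMax π₀ sel R))
    (fun x => hsel.sub_le_deltaMax hC1 p (hsel.mem_support hg x))
  simpa [oneStepRegret] using this

lemma gap_mul_measure_le_oneStepRegret [IsProbabilityMeasure d₀]
    (hRmeas : ∀ p, Measurable fun z : X × A => R p z.1 z.2)
    (hsel : IsArgmaxSelector π₀ (insert 0 (Set.range R)) sel)
    (hC1 : CompactContinuous d₀ π₀ R) {Δ : ℝ}
    (hgap : ∀ p, ∀ᵐ x ∂d₀, ∀ a ∈ (π₀ x).support, a ≠ sel (R p) x →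
      R p x a + Δ ≤ R p x (sel (R p) x)) (p q : P) :
    Δ * d₀.real {x | sel (R p) x ≠ sel (R q) x} ≤ oneStepRegret d₀ sel (R p) (R q) := by
  have hS : MeasurableSet {x | sel (R p) x ≠ sel (R q) x} :=
    (measurableSet_eq_fun (hsel (R p) (by simp)).1 (hsel (R q) (by simp)).1).compl
  have : Δ * d₀.real {x | sel (R p) x ≠ sel (R q) x} =
      ∫ x, {x | sel (R p) x ≠ sel (R q) x}.indicator (fun _ => Δ) x ∂d₀ := by
    rw [integral_indicator_const _ hS, smul_eq_mul, mul_comm]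
  rw [this]
  refine integral_mono_ae ((integrable_const Δ).indicator hS)
    (integrable_regret hRmeas hsel hC1 p (by simp)) ?_
  filter_upwards [hgap p] with x hx
  by_cases h : sel (R p) x = sel (R q) x
  · simp [h]
  · have h1 := hx _ (hsel.mem_support (f := R q) (by simp) x) (Ne.symm h)
    rw [Set.indicator_of_mem (by exact h)]
    linarith

/-- Positive regrets within the class are bounded away from zero: up to null sets there are finitely
many selectors, and two different ones disagree with positive probability, each time at the cost of
the reward gap. -/
lemma exists_isolatesRegret [IsProbabilityMeasure d₀]
    (hRmeas : ∀ p, Measurable fun z : X × A => R p z.1 z.2)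
    (hsel : IsArgmaxSelector π₀ (insert 0 (Set.range R)) sel)
    (hC1 : CompactContinuous d₀ π₀ R) (hC2 : HasRewardGap d₀ π₀ sel R) :
    ∃ ε₀ : ℝ, 0 < ε₀ ∧ IsolatesRegret d₀ sel R ε₀ := by
  obtain ⟨Δ, hΔ, hgap⟩ := hC2
  obtain ⟨-, I, -, hI⟩ := exists_finset_net hC1.compact (half_pos hΔ)
  have hsame : ∀ p, ∃ i ∈ I, sel (R p) =ᵐ[d₀] sel (R i) := fun p => by
    obtain ⟨i, hi, h⟩ := hI p
    exact ⟨i, hi, ae_sel_eq_of_close hsel hgap fun z hz => (h z hz).trans_lt (half_lt_self hΔ)⟩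
  let m : P × P → ℝ := fun ij => d₀.real {x | sel (R ij.1) x ≠ sel (R ij.2) x}
  have hzero : ∀ p q, m (p, q) = 0 → sel (R p) =ᵐ[d₀] sel (R q) := fun p q h => by
    rw [Filter.EventuallyEq, ae_iff]
    exact (measureReal_eq_zero_iff).1 h
  obtain ⟨c, hc, hcm⟩ : ∃ c : ℝ, 0 < c ∧ ∀ ij ∈ I ×ˢ I, m ij = 0 ∨ c ≤ m ij := by
    rcases ((I ×ˢ I).filter fun ij => m ij ≠ 0).eq_empty_or_nonempty with he | hne
    · refine ⟨1, one_pos, fun ij hij => Or.inl ?_⟩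
      by_contra h0
      have : ij ∈ (I ×ˢ I).filter fun ij => m ij ≠ 0 := Finset.mem_filter.2 ⟨hij, h0⟩
      simp [he] at this
    · obtain ⟨k, hk, hmin⟩ := Finset.exists_min_image _ m hne
      refine ⟨m k, lt_of_le_of_ne measureReal_nonneg (Finset.mem_filter.1 hk).2.symm,
        fun ij hij => ?_⟩
      by_cases h0 : m ij = 0
      · exact Or.inl h0
      · exact Or.inr (hmin ij (Finset.mem_filter.2 ⟨hij, h0⟩))
  refine ⟨Δ * c, mul_pos hΔ hc, fun p q => ?_⟩
  obtain ⟨i, hi, hpi⟩ := hsame p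
  obtain ⟨j, hj, hqj⟩ := hsame q
  rcases hcm (i, j) (Finset.mk_mem_product hi hj) with h | h
  · exact Or.inl (oneStepRegret_eq_zero ((hpi.trans (hzero i j h)).trans hqj.symm))
  · refine Or.inr (le_trans ?_ (gap_mul_measure_le_oneStepRegret hRmeas hsel hC1 hgap p q))
    have heq : m (p, q) = m (i, j) := by
      refine measureReal_congr ?_
      filter_upwards [hpi, hqj] with x h1 h2
      change (sel (R p) x ≠ sel (R q) x) = (sel (R i) x ≠ sel (R j) x)
      rw [h1, h2]
    exact mul_le_mul_of_nonneg_left (h.trans heq.ge) hΔ.le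

end RewardClass

/-! ### Laws of slates and rounds -/

section Laws

variable {X A : Type*} [MeasurableSpace X] [MeasurableSpace A] {K : ℕ}

lemma pow_smul_pi_le {ι α : Type*} [Fintype ι] [MeasurableSpace α] {μ ν : Measure α} [SigmaFinite μ]
    {c : ℝ≥0∞} (h : c • μ ≤ ν) :
    c ^ Fintype.card ι • Measure.pi (fun _ : ι => μ) ≤ Measure.pi fun _ : ι => ν := by
  have hle : (c ^ Fintype.card ι • Measure.pi (fun _ : ι => μ)).toOuterMeasure ≤
      OuterMeasure.pi fun _ : ι => ν.toOuterMeasure := by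
    refine OuterMeasure.le_pi.2 fun s _ => ?_
    change (c ^ Fintype.card ι • Measure.pi (fun _ : ι => μ)) (Set.univ.pi s) ≤ ∏ i, ν (s i)
    rw [Measure.smul_apply, Measure.pi_pi, smul_eq_mul, ← Finset.card_univ, ← Finset.prod_const,
      ← Finset.prod_mul_distrib]
    exact Finset.prod_le_prod' fun i _ => h (s i)
  refine Measure.le_iff.2 fun s hs => ?_
  rw [Measure.pi_def fun _ : ι => ν, toMeasure_apply _ _ hs]
  exact hle s

lemma measurable_slate_eval {f : X → A → ℝ} (hf : Measurable fun z : X × A => f z.1 z.2) :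
    Measurable fun z : X × (Fin K → A) => fun k => f z.1 (z.2 k) :=
  measurable_pi_lambda _ fun k =>
    hf.comp (by fun_prop : Measurable fun z : X × (Fin K → A) => (z.1, z.2 k))

lemma measurable_roundLoss {f : X → A → ℝ} (hf : Measurable fun z : X × A => f z.1 z.2) :
    Measurable fun z : Round X A K => roundLoss f z := by
  have h1 : Measurable fun z : (X × (Fin K → A)) × Fin K =>
      mnlLoss (fun k => f z.1.1 (z.1.2 k)) z.2 :=
    measurable_from_prod_countable_left fun y =>
      (continuous_mnlLoss y).measurable.comp (measurable_slate_eval hf)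
  exact h1.comp (by fun_prop : Measurable fun z : Round X A K => ((z.1, z.2.1), z.2.2))

lemma lintegral_choiceLaw (f : X → A → ℝ) (x : X) (a : Fin K → A) {F : Round X A K → ℝ≥0∞}
    (hF : Measurable F) : ∫⁻ z, F z ∂(choiceLaw f x a) =
      ∑ k, ENNReal.ofReal (mnlProb (fun j => f x (a j)) k) * F (x, a, k) := by
  simp only [choiceLaw, lintegral_finsetSum_measure, lintegral_smul_measure, smul_eq_mul]
  exact Finset.sum_congr rfl fun k _ => by rw [lintegral_dirac' _ hF]

lemma measurable_choice_kernel {f : X → A → ℝ} (hf : Measurable fun z : X × A => f z.1 z.2)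
    (x : X) : Measurable fun a : Fin K → A => choiceLaw f x a :=
  (measurable_choiceLaw K f hf).comp (g := fun z : X × (Fin K → A) => choiceLaw f z.1 z.2)
    (f := Prod.mk x) measurable_prodMk_left

lemma lintegral_roundLaw {d₀ : Measure X} {π : X → Measure A} (hπ : Measurable π)
    (hp : ∀ x, IsProbabilityMeasure (π x)) {f : X → A → ℝ}
    (hf : Measurable fun z : X × A => f z.1 z.2) {F : Round X A K → ℝ≥0∞} (hF : Measurable F) :
    ∫⁻ z, F z ∂(roundLaw K d₀ π f) = ∫⁻ x, ∫⁻ a : Fin K → A,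
      ∑ k, ENNReal.ofReal (mnlProb (fun j => f x (a j)) k) * F (x, a, k)
        ∂(Measure.pi fun _ : Fin K => π x) ∂d₀ := by
  rw [roundLaw, Measure.lintegral_bind (measurable_bind_dep (measurable_pi_const hπ hp K)
    (fun x => inferInstance) (measurable_choiceLaw K f hf)).aemeasurable hF.aemeasurable]
  refine lintegral_congr fun x => ?_
  rw [Measure.lintegral_bind (measurable_choice_kernel hf x).aemeasurable hF.aemeasurable]
  exact lintegral_congr fun a => lintegral_choiceLaw f x a hF

/-- The kernel drawing a slate of `K` independent actions from `π₀`. -/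
noncomputable def slateKernel (K : ℕ) (π₀ : Kernel X A) [IsMarkovKernel π₀] :
    Kernel X (Fin K → A) :=
  ⟨fun x => Measure.pi fun _ => π₀ x, measurable_pi_const π₀.measurable (fun _ => inferInstance) K⟩

instance (K : ℕ) (π₀ : Kernel X A) [IsMarkovKernel π₀] : IsMarkovKernel (slateKernel K π₀) :=
  ⟨fun x => inferInstanceAs (IsProbabilityMeasure (Measure.pi fun _ : Fin K => π₀ x))⟩

/-- The joint law of a context and a slate of `K` independent reference actions. -/
noncomputable def slateLaw (K : ℕ) (d₀ : Measure X) (π₀ : Kernel X A) [IsMarkovKernel π₀] :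
    Measure (X × (Fin K → A)) :=
  d₀ ⊗ₘ slateKernel K π₀

instance (d₀ : Measure X) [IsProbabilityMeasure d₀] (π₀ : Kernel X A) [IsMarkovKernel π₀] :
    IsProbabilityMeasure (slateLaw K d₀ π₀) := by
  unfold slateLaw; infer_instance

variable {d₀ : Measure X} [IsProbabilityMeasure d₀] {π₀ : Kernel X A} [IsMarkovKernel π₀]

lemma lintegral_slateLaw {F : X × (Fin K → A) → ℝ≥0∞} (hF : Measurable F) :
    ∫⁻ z, F z ∂(slateLaw K d₀ π₀) =
      ∫⁻ x, ∫⁻ a, F (x, a) ∂(Measure.pi fun _ : Fin K => π₀ x) ∂d₀ :=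
  Measure.lintegral_compProd hF

/-- Expectations under a round with reference slates, with the preferred index averaged out. -/
lemma integral_roundLaw {f : X → A → ℝ} (hf : Measurable fun z : X × A => f z.1 z.2)
    {F : Round X A K → ℝ} (hF : Measurable F) (h0 : ∀ z, 0 ≤ F z) :
    ∫ z, F z ∂(roundLaw K d₀ π₀ f) =
      ∫ z, ∑ k, mnlProb (fun j => f z.1 (z.2 j)) k * F (z.1, z.2, k) ∂(slateLaw K d₀ π₀) := by
  have hm : Measurable fun z : X × (Fin K → A) =>
      ∑ k, mnlProb (fun j => f z.1 (z.2 j)) k * F (z.1, z.2, k) :=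
    Finset.measurable_sum _ fun k _ =>
      ((continuous_mnlProb k).measurable.comp (measurable_slate_eval hf)).mul
        (hF.comp (by fun_prop))
  rw [integral_eq_lintegral_of_nonneg_ae (Filter.Eventually.of_forall h0)
      hF.aestronglyMeasurable,
    integral_eq_lintegral_of_nonneg_ae (Filter.Eventually.of_forall fun z =>
      Finset.sum_nonneg fun k _ => mul_nonneg (mnlProb_nonneg _ _) (h0 _)) hm.aestronglyMeasurable,
    lintegral_roundLaw π₀.measurable (fun _ => inferInstance) hf hF.ennreal_ofReal,
    lintegral_slateLaw hm.ennreal_ofReal]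
  congr 1
  refine lintegral_congr fun x => lintegral_congr fun a => ?_
  rw [ENNReal.ofReal_sum_of_nonneg fun k _ => mul_nonneg (mnlProb_nonneg _ _) (h0 _)]
  exact Finset.sum_congr rfl fun k _ => (ENNReal.ofReal_mul (mnlProb_nonneg _ _)).symm

end Laws

section SupportedLaws

variable {X A : Type*} [MeasurableSpace X] [MetricSpace A] [SecondCountableTopology A]
  [MeasurableSpace A] [BorelSpace A] {K : ℕ} {d₀ : Measure X} [IsProbabilityMeasure d₀]
  {π₀ : Kernel X A} [IsMarkovKernel π₀]

lemma ae_pi_mem_support {μ : Measure A} {ν : Measure A} [IsProbabilityMeasure ν] (h : ν ≪ μ) :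
    ∀ᵐ a ∂(Measure.pi fun _ : Fin K => ν), ∀ k, a k ∈ μ.support :=
  ae_all_iff.2 fun _ => Measure.tendsto_eval_ae_ae.eventually (h.ae_le Measure.support_mem_ae)

lemma measurableSet_slate_mem_support :
    MeasurableSet {z : X × (Fin K → A) | ∀ k, z.2 k ∈ (π₀ z.1).support} := by
  have : {z : X × (Fin K → A) | ∀ k, z.2 k ∈ (π₀ z.1).support} =
      ⋂ k, (fun z : X × (Fin K → A) => (z.1, z.2 k)) ⁻¹' suppGraph π₀ := by
    ext z; simp [suppGraph]
  rw [this]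
  exact MeasurableSet.iInter fun k => measurableSet_suppGraph.preimage (by fun_prop)

lemma ae_slateLaw_mem_support :
    ∀ᵐ z ∂(slateLaw K d₀ π₀), ∀ k, z.2 k ∈ (π₀ z.1).support := by
  rw [slateLaw, Measure.ae_compProd_iff measurableSet_slate_mem_support]
  refine Filter.Eventually.of_forall fun x => ?_
  have h := ae_pi_mem_support (K := K) (Measure.AbsolutelyContinuous.refl (π₀ x))
  exact h

lemma ae_roundLaw_mem_support {π : X → Measure A} (hπ : Measurable π)
    (hp : ∀ x, IsProbabilityMeasure (π x)) (hac : ∀ x, π x ≪ π₀ x) {f : X → A → ℝ}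
    (hf : Measurable fun z : X × A => f z.1 z.2) :
    ∀ᵐ z ∂(roundLaw K d₀ π f), ∀ k, z.2.1 k ∈ (π₀ z.1).support := by
  have hS : MeasurableSet {z : Round X A K | ∀ k, z.2.1 k ∈ (π₀ z.1).support} :=
    measurableSet_slate_mem_support.preimage
      (by fun_prop : Measurable fun z : Round X A K => (z.1, z.2.1))
  rw [ae_iff]
  change roundLaw K d₀ π f {z : Round X A K | ∀ k, z.2.1 k ∈ (π₀ z.1).support}ᶜ = 0
  rw [← lintegral_indicator_one hS.compl,
    lintegral_roundLaw hπ hp hf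
      (measurable_one.indicator hS.compl),
    lintegral_eq_zero_of_ae_eq_zero]
  refine Filter.Eventually.of_forall fun x => lintegral_eq_zero_of_ae_eq_zero ?_
  filter_upwards [ae_pi_mem_support (K := K) (hac x)] with a ha
  simp [ha]

/-! ### The tilted policy -/

section Tilt

variable {η B : ℝ} {f : X → A → ℝ}

lemma integrable_exp_of_bound (hη : 0 ≤ η) (hf : Measurable fun z : X × A => f z.1 z.2) (x : X)
    (hB : ∀ a ∈ (π₀ x).support, |f x a| ≤ B) :
    Integrable (fun a => Real.exp (η * f x a)) (π₀ x) := by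
  refine Integrable.of_bound (C := Real.exp (η * B)) ?_ ?_
  · exact (Real.measurable_exp.comp
      ((hf.comp measurable_prodMk_left).const_mul η)).aestronglyMeasurable
  · filter_upwards [Measure.support_mem_ae (μ := π₀ x)] with a ha
    rw [Real.norm_of_nonneg (Real.exp_pos _).le, Real.exp_le_exp]
    exact mul_le_mul_of_nonneg_left (abs_le.1 (hB a ha)).2 hη

/-- The tilted policy dominates a fixed fraction of the reference policy: the density is at least
`exp (-η B) / exp (η B)`. -/
lemma smul_le_klTilt (hη : 0 ≤ η) (hf : Measurable fun z : X × A => f z.1 z.2) (x : X)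
    (hB : ∀ a ∈ (π₀ x).support, |f x a| ≤ B) :
    ENNReal.ofReal (Real.exp (2 * η * B))⁻¹ • π₀ x ≤ klTilt π₀ η f x := by
  have hint := integrable_exp_of_bound hη hf x hB
  have hZpos : 0 < ∫ a, Real.exp (η * f x a) ∂(π₀ x) := integral_exp_pos hint
  have hZ : ∫ a, Real.exp (η * f x a) ∂(π₀ x) ≤ Real.exp (η * B) := by
    have := integral_mono_ae hint (integrable_const (Real.exp (η * B))) (by
      filter_upwards [Measure.support_mem_ae (μ := π₀ x)] with a ha
      exact Real.exp_le_exp.2 (mul_le_mul_of_nonneg_left (abs_le.1 (hB a ha)).2 hη))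
    simpa using this
  rw [klTilt, Measure.tilted, ← withDensity_const]
  refine withDensity_mono ?_
  filter_upwards [Measure.support_mem_ae (μ := π₀ x)] with a ha
  refine ENNReal.ofReal_le_ofReal ?_
  rw [le_div_iff₀ hZpos, ← Real.exp_neg]
  calc Real.exp (-(2 * η * B)) * ∫ a, Real.exp (η * f x a) ∂(π₀ x)
      ≤ Real.exp (-(2 * η * B)) * Real.exp (η * B) :=
        mul_le_mul_of_nonneg_left hZ (Real.exp_pos _).le
    _ = Real.exp (η * -B) := by rw [← Real.exp_add]; congr 1; ring
    _ ≤ _ := Real.exp_le_exp.2 (mul_le_mul_of_nonneg_left (abs_le.1 (hB a ha)).1 hη)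

lemma measurable_klTilt_policy (hf : Measurable fun z : X × A => f z.1 z.2) :
    Measurable (klTilt π₀ η f) := by
  have hf' : Measurable fun w : Unit × X × A => f w.2.1 w.2.2 := hf.comp measurable_snd
  have h := measurable_klTilt π₀ η (fun _ : Unit => f) hf'
  have h2 : Measurable fun x : X => ((), x) := measurable_prodMk_left
  have h3 := h.comp h2
  exact h3

lemma isProbabilityMeasure_klTilt (hη : 0 ≤ η) (hf : Measurable fun z : X × A => f z.1 z.2)
    (hB : ∀ x, ∀ a ∈ (π₀ x).support, |f x a| ≤ B) (x : X) :
    IsProbabilityMeasure (klTilt π₀ η f x) :=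
  isProbabilityMeasure_tilted (integrable_exp_of_bound hη hf x (hB x))

end Tilt

/-! ### Excess loss as an expected divergence -/

variable {B : ℝ} {f g : X → A → ℝ}

lemma measurable_mnlKL_slate (hf : Measurable fun z : X × A => f z.1 z.2)
    (hg : Measurable fun z : X × A => g z.1 z.2) :
    Measurable fun z : X × (Fin K → A) =>
      mnlKL (fun j => f z.1 (z.2 j)) (fun j => g z.1 (z.2 j)) :=
  continuous_mnlKL.measurable.comp ((measurable_slate_eval hf).prodMk (measurable_slate_eval hg))

lemma integrable_mnlKL_slate (hK : 0 < K) (hf : Measurable fun z : X × A => f z.1 z.2)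
    (hg : Measurable fun z : X × A => g z.1 z.2)
    (hgB : ∀ x, ∀ a ∈ (π₀ x).support, |g x a| ≤ B) :
    Integrable (fun z : X × (Fin K → A) =>
      mnlKL (fun j => f z.1 (z.2 j)) (fun j => g z.1 (z.2 j))) (slateLaw K d₀ π₀) := by
  refine Integrable.of_bound (measurable_mnlKL_slate hf hg).aestronglyMeasurable
    (Real.log K + 2 * B) ?_
  filter_upwards [ae_slateLaw_mem_support] with z hz
  rw [Real.norm_of_nonneg (mnlKL_nonneg _ _)]
  exact mnlKL_le hK fun k => hgB _ _ (hz k)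

lemma popLoss_sub_popLoss (hK : 0 < K) (hf : Measurable fun z : X × A => f z.1 z.2)
    (hg : Measurable fun z : X × A => g z.1 z.2)
    (hfB : ∀ x, ∀ a ∈ (π₀ x).support, |f x a| ≤ B)
    (hgB : ∀ x, ∀ a ∈ (π₀ x).support, |g x a| ≤ B) :
    popLoss K d₀ π₀ f g - popLoss K d₀ π₀ f f =
      ∫ z, mnlKL (fun j => f z.1 (z.2 j)) (fun j => g z.1 (z.2 j)) ∂(slateLaw K d₀ π₀) := by
  have hint : ∀ h : X → A → ℝ, (Measurable fun z : X × A => h z.1 z.2) →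
      (∀ x, ∀ a ∈ (π₀ x).support, |h x a| ≤ B) →
      Integrable (fun z : X × (Fin K → A) => ∑ k, mnlProb (fun j => f z.1 (z.2 j)) k *
        mnlLoss (fun j => h z.1 (z.2 j)) k) (slateLaw K d₀ π₀) := fun h hh hhB => by
    refine Integrable.of_bound (Measurable.aestronglyMeasurable ?_) (Real.log K + 2 * B) ?_
    · exact Finset.measurable_sum _ fun k _ =>
        ((continuous_mnlProb k).measurable.comp (measurable_slate_eval hf)).mul
          ((continuous_mnlLoss k).measurable.comp (measurable_slate_eval hh))
    · filter_upwards [ae_slateLaw_mem_support] with z hz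
      rw [Real.norm_of_nonneg (Finset.sum_nonneg fun k _ =>
        mul_nonneg (mnlProb_nonneg _ _) (mnlLoss_nonneg _ _))]
      calc _ ≤ ∑ k, mnlProb (fun j => f z.1 (z.2 j)) k * (Real.log K + 2 * B) :=
            Finset.sum_le_sum fun k _ => mul_le_mul_of_nonneg_left
              (mnlLoss_le (fun k => hhB _ _ (hz k)) k) (mnlProb_nonneg _ _)
        _ = _ := by rw [← Finset.sum_mul, sum_mnlProb hK, one_mul]
  rw [popLoss, popLoss, integral_roundLaw hf (measurable_roundLoss hg) fun z => mnlLoss_nonneg _ _,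
    integral_roundLaw hf (measurable_roundLoss hf) fun z => mnlLoss_nonneg _ _]
  simp only [roundLoss]
  rw [← integral_sub (hint g hg hgB) (hint f hf hfB)]
  simp only [mnlKL, mul_sub, Finset.sum_sub_distrib]

lemma sum_ofReal_mnlProb_mul_exp_le {v w : Fin K → ℝ} {M s : ℝ} (hK : 0 < K)
    (hv : ∀ k, |v k| ≤ B) (hw : ∀ k, |w k| ≤ B)
    (hM : M = Real.log K + 2 * B) (hs : 0 ≤ s) (hsM : s * M ≤ 1) :
    ∑ k, ENNReal.ofReal (mnlProb v k) *
        ENNReal.ofReal (Real.exp (-(s * (mnlLoss w k - mnlLoss v k)))) +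
      ENNReal.ofReal (s * mnlKL v w) ≤ ENNReal.ofReal (1 + (s * M) ^ 2) := by
  simp only [← ENNReal.ofReal_mul (mnlProb_nonneg _ _)]
  have h0 : ∀ k ∈ Finset.univ,
      0 ≤ mnlProb v k * Real.exp (-(s * (mnlLoss w k - mnlLoss v k))) := fun k _ =>
    mul_nonneg (mnlProb_nonneg _ _) (Real.exp_pos _).le
  rw [← ENNReal.ofReal_sum_of_nonneg h0,
    ← ENNReal.ofReal_add (Finset.sum_nonneg h0) (mul_nonneg hs (mnlKL_nonneg _ _))]
  refine ENNReal.ofReal_le_ofReal (sum_mnlProb_mul_exp_le hK (fun k => ?_) hs hsM)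
  have h1 := mnlLoss_le hv k
  have h2 := mnlLoss_le hw k
  have h3 := mnlLoss_nonneg v k
  have h4 := mnlLoss_nonneg w k
  rw [abs_le, hM]
  constructor <;> linarith

/-- One round of the exponential moment bound. Playing a tilted policy, the excess loss of `g` has
conditional mean at least `exp (2 η B) ^ (-K)` times the excess population loss under reference
slates, since each of the `K` coordinates loses at most a factor `exp (2 η B)` of density. -/
lemma lintegral_exp_neg_excessLoss_le (hK : 0 < K) {η s M m : ℝ} (hη : 0 ≤ η)
    {u : X → A → ℝ} (hu : Measurable fun z : X × A => u z.1 z.2)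
    (huB : ∀ x, ∀ a ∈ (π₀ x).support, |u x a| ≤ B)
    (hf : Measurable fun z : X × A => f z.1 z.2) (hg : Measurable fun z : X × A => g z.1 z.2)
    (hfB : ∀ x, ∀ a ∈ (π₀ x).support, |f x a| ≤ B)
    (hgB : ∀ x, ∀ a ∈ (π₀ x).support, |g x a| ≤ B)
    (hM : M = Real.log K + 2 * B) (hs : 0 ≤ s) (hsM : s * M ≤ 1)
    (hm : m ≤ (Real.exp (2 * η * B) ^ K)⁻¹ * (popLoss K d₀ π₀ f g - popLoss K d₀ π₀ f f)) :
    ∫⁻ z, ENNReal.ofReal (Real.exp (-(s * (roundLoss g z - roundLoss f z))))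
      ∂(roundLaw K d₀ (klTilt π₀ η u) f) ≤ ENNReal.ofReal (Real.exp ((s * M) ^ 2 - s * m)) := by
  have hp := isProbabilityMeasure_klTilt hη hu huB
  have hmeas := measurable_klTilt_policy (π₀ := π₀) (η := η) hu
  have hL : Measurable fun z : Round X A K =>
      ENNReal.ofReal (Real.exp (-(s * (roundLoss g z - roundLoss f z)))) :=
    (Real.measurable_exp.comp (((measurable_roundLoss hg).sub
      (measurable_roundLoss hf)).const_mul s).neg).ennreal_ofReal
  have hKL := measurable_mnlKL_slate (K := K) hf hg
  rw [popLoss_sub_popLoss hK hf hg hfB hgB] at hm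
  set κ := ∫ z, mnlKL (fun j => f z.1 (z.2 j)) (fun j => g z.1 (z.2 j)) ∂(slateLaw K d₀ π₀) with hκ
  set b := (Real.exp (2 * η * B) ^ K)⁻¹ with hb
  have hb0 : 0 ≤ b := by positivity
  have hκ0 : 0 ≤ κ := integral_nonneg fun z => mnlKL_nonneg _ _
  -- the expected divergence under the tilted slates dominates that under reference slates
  have hlow : ENNReal.ofReal (s * (b * κ)) ≤ ∫⁻ x, ∫⁻ a : Fin K → A,
      ENNReal.ofReal (s * mnlKL (fun j => f x (a j)) (fun j => g x (a j)))
        ∂(Measure.pi fun _ : Fin K => klTilt π₀ η u x) ∂d₀ := by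
    have h1 : ENNReal.ofReal (s * (b * κ)) = ENNReal.ofReal b *
        ∫⁻ z, ENNReal.ofReal (s * mnlKL (fun j => f z.1 (z.2 j)) (fun j => g z.1 (z.2 j)))
          ∂(slateLaw K d₀ π₀) := by
      rw [← ofReal_integral_eq_lintegral_ofReal
        ((integrable_mnlKL_slate hK hf hg hgB).const_mul s)
        (Filter.Eventually.of_forall fun z => mul_nonneg hs (mnlKL_nonneg _ _)),
        integral_const_mul, ← hκ, ← ENNReal.ofReal_mul hb0]
      congr 1; ring
    rw [h1, lintegral_slateLaw (hKL.const_mul s).ennreal_ofReal,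
      ← lintegral_const_mul' _ _ ENNReal.ofReal_ne_top]
    refine lintegral_mono fun x => ?_
    have h2 := pow_smul_pi_le (ι := Fin K) (smul_le_klTilt hη hu x (huB x))
    have h3 : ENNReal.ofReal (Real.exp (2 * η * B))⁻¹ ^ Fintype.card (Fin K) =
        ENNReal.ofReal b := by
      rw [Fintype.card_fin, ← ENNReal.ofReal_pow (by positivity), hb, inv_pow]
    rw [h3] at h2
    rw [← smul_eq_mul, ← lintegral_smul_measure]
    exact lintegral_mono' h2 le_rfl
  have hsum : ∫⁻ z, ENNReal.ofReal (Real.exp (-(s * (roundLoss g z - roundLoss f z))))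
      ∂(roundLaw K d₀ (klTilt π₀ η u) f) + ENNReal.ofReal (s * (b * κ)) ≤
        ENNReal.ofReal (1 + (s * M) ^ 2) := by
    refine (add_le_add le_rfl hlow).trans ?_
    rw [lintegral_roundLaw hmeas hp hf hL]
    have hpt : ∀ x, ∫⁻ a : Fin K → A, ∑ k, ENNReal.ofReal (mnlProb (fun j => f x (a j)) k) *
          ENNReal.ofReal (Real.exp (-(s * (roundLoss g (x, a, k) - roundLoss f (x, a, k)))))
            ∂(Measure.pi fun _ : Fin K => klTilt π₀ η u x) +
        ∫⁻ a : Fin K → A, ENNReal.ofReal (s * mnlKL (fun j => f x (a j)) (fun j => g x (a j)))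
            ∂(Measure.pi fun _ : Fin K => klTilt π₀ η u x) ≤ ENNReal.ofReal (1 + (s * M) ^ 2) := by
      intro x
      have := hp x
      have hKLx : Measurable fun a : Fin K → A =>
          ENNReal.ofReal (s * mnlKL (fun j => f x (a j)) (fun j => g x (a j))) :=
        ((hKL.comp (measurable_prodMk_left (x := x))).const_mul s).ennreal_ofReal
      rw [← lintegral_add_right _ hKLx]
      have hac : klTilt π₀ η u x ≪ π₀ x := tilted_absolutelyContinuous _ _
      have hle := lintegral_mono_ae (μ := Measure.pi fun _ : Fin K => klTilt π₀ η u x)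
        ((ae_pi_mem_support (K := K) hac).mono fun a ha =>
          sum_ofReal_mnlProb_mul_exp_le hK (fun j => hfB x _ (ha j)) (fun j => hgB x _ (ha j))
            hM hs hsM)
      rw [lintegral_const, measure_univ, mul_one] at hle
      exact hle
    have hmeasL : Measurable fun x => ∫⁻ a : Fin K → A,
        ENNReal.ofReal (s * mnlKL (fun j => f x (a j)) (fun j => g x (a j)))
          ∂(Measure.pi fun _ : Fin K => klTilt π₀ η u x) := by
      let κ' : Kernel X (Fin K → A) := ⟨_, measurable_pi_const hmeas hp K⟩
      have : IsMarkovKernel κ' := ⟨fun x => by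
        have := hp x
        exact inferInstanceAs (IsProbabilityMeasure (Measure.pi fun _ : Fin K => klTilt π₀ η u x))⟩
      exact Measurable.lintegral_kernel_prod_right (κ := κ')
        (f := fun x a => ENNReal.ofReal (s * mnlKL (fun j => f x (a j)) (fun j => g x (a j))))
        (hKL.const_mul s).ennreal_ofReal
    rw [← lintegral_add_right _ hmeasL]
    calc _ ≤ ∫⁻ _x, ENNReal.ofReal (1 + (s * M) ^ 2) ∂d₀ := lintegral_mono hpt
      _ = _ := by simp
  refine (ENNReal.le_sub_of_add_le_right ENNReal.ofReal_ne_top hsum).trans ?_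
  rw [← ENNReal.ofReal_sub _ (by positivity)]
  refine ENNReal.ofReal_le_ofReal ?_
  have h1 := Real.add_one_le_exp ((s * M) ^ 2 - s * m)
  have h2 : s * m ≤ s * (b * κ) := mul_le_mul_of_nonneg_left hm hs
  linarith

end SupportedLaws

/-! ### The law of the history -/

section HistoryLaw

variable {X A : Type*} [MeasurableSpace X] [MetricSpace A] [SecondCountableTopology A]
  [MeasurableSpace A] [BorelSpace A] {K : ℕ} {d₀ : Measure X} [IsProbabilityMeasure d₀]
  {π₀ : Kernel X A} [IsMarkovKernel π₀] {η B : ℝ} {f g : X → A → ℝ}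
  {Rhat : (t : ℕ) → History X A K t → X → A → ℝ}

lemma measurable_snoc_history (t : ℕ) : Measurable fun w : History X A K t × Round X A K =>
    (Fin.snoc w.1 w.2 : History X A K (t + 1)) := by
  refine measurable_pi_lambda _ fun i => ?_
  refine Fin.lastCases ?_ (fun j => ?_) i
  · simpa using measurable_snd
  · simp only [Fin.snoc_castSucc]
    exact (measurable_pi_apply j).comp measurable_fst

/-- Integration against the law of `t + 1` rounds: integrate out the last round first. -/
lemma lintegral_historyLaw_succ (hK : 0 < K) (hη : 0 ≤ η)
    (hf : Measurable fun z : X × A => f z.1 z.2)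
    (hR : ∀ t, Measurable fun w : History X A K t × X × A => Rhat t w.1 w.2.1 w.2.2)
    (hRB : ∀ t h x, ∀ a ∈ (π₀ x).support, |Rhat t h x a| ≤ B) (t : ℕ)
    {F : History X A K (t + 1) → ℝ≥0∞} (hF : Measurable F) :
    ∫⁻ h, F h ∂(historyLaw K d₀ π₀ η f Rhat (t + 1)) =
      ∫⁻ h, ∫⁻ z, F (Fin.snoc h z : History X A K (t + 1))
        ∂(roundLaw K d₀ (klTilt π₀ η (Rhat t h)) f) ∂(historyLaw K d₀ π₀ η f Rhat t) := by
  have hR1 : ∀ h, Measurable fun z : X × A => Rhat t h z.1 z.2 := fun h =>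
    (hR t).comp (measurable_prodMk_left (x := h))
  have hp : ∀ h x, IsProbabilityMeasure (klTilt π₀ η (Rhat t h) x) := fun h =>
    isProbabilityMeasure_klTilt hη (hR1 h) (hRB t h)
  have hT := measurable_klTilt π₀ η (Rhat t) (hR t)
  have hs := measurable_snoc_history (X := X) (A := A) (K := K) t
  have hrp : ∀ h, IsProbabilityMeasure (roundLaw K d₀ (klTilt π₀ η (Rhat t h)) f) := fun h =>
    isProbabilityMeasure_roundLaw hK d₀ _ (measurable_klTilt_policy (hR1 h)) (hp h) f hf
  have hr : Measurable fun h : History X A K t =>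
      roundLaw K d₀ (klTilt π₀ η (Rhat t h)) f := by
    unfold roundLaw
    have h2 : ∀ w : History X A K t × X,
        IsProbabilityMeasure (Measure.pi fun _ : Fin K => klTilt π₀ η (Rhat t w.1) w.2) :=
      fun w => by have := hp w.1 w.2; infer_instance
    have h4 := (measurable_choiceLaw K f hf).comp
      (by fun_prop : Measurable fun z : (History X A K t × X) × (Fin K → A) => (z.1.2, z.2))
    have h3 := measurable_bind_dep
      (f := fun (w : History X A K t × X) (a : Fin K → A) => choiceLaw f w.2 a)
      (measurable_pi_const hT (fun w => hp w.1 w.2) K) h2 h4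
    exact measurable_bind_dep (m := fun _ : History X A K t => d₀)
      (f := fun h' x => (Measure.pi fun _ : Fin K => klTilt π₀ η (Rhat t h') x).bind
        fun a => choiceLaw f x a) measurable_const (fun _ => inferInstance) h3
  have hs1 : ∀ h : History X A K t,
      Measurable fun z : Round X A K => (Fin.snoc h z : History X A K (t + 1)) := fun h =>
    hs.comp (measurable_prodMk_left (x := h))
  have hmap : Measurable fun h : History X A K t =>
      (roundLaw K d₀ (klTilt π₀ η (Rhat t h)) f).map
        fun z => (Fin.snoc h z : History X A K (t + 1)) := by
    refine Measure.measurable_of_measurable_coe _ fun s hs' => ?_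
    have heq : ∀ h : History X A K t, ((roundLaw K d₀ (klTilt π₀ η (Rhat t h)) f).map
        fun z => (Fin.snoc h z : History X A K (t + 1))) s =
        (roundLaw K d₀ (klTilt π₀ η (Rhat t h)) f)
          (Prod.mk h ⁻¹' ((fun w : History X A K t × Round X A K =>
            (Fin.snoc w.1 w.2 : History X A K (t + 1))) ⁻¹' s)) := fun h =>
      Measure.map_apply (hs1 h) hs'
    simp_rw [heq]
    let κ : Kernel (History X A K t) (Round X A K) := ⟨_, hr⟩
    have : IsMarkovKernel κ := ⟨hrp⟩
    exact Kernel.measurable_kernel_prodMk_left (κ := κ) (hs hs')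
  rw [historyLaw, Measure.lintegral_bind hmap.aemeasurable hF.aemeasurable]
  exact lintegral_congr fun h => lintegral_map hF (hs1 h)

lemma measurableSet_history_mem_support (t : ℕ) : MeasurableSet
    {h : History X A K t | ∀ s k, (h s).2.1 k ∈ (π₀ (h s).1).support} := by
  have : {h : History X A K t | ∀ s k, (h s).2.1 k ∈ (π₀ (h s).1).support} =
      ⋂ s, ⋂ k, (fun h : History X A K t => ((h s).1, (h s).2.1 k)) ⁻¹' suppGraph π₀ := by
    ext h; simp [suppGraph]
  rw [this]
  exact MeasurableSet.iInter fun s => MeasurableSet.iInter fun k =>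
    measurableSet_suppGraph.preimage (by fun_prop)

lemma ae_historyLaw_mem_support (hK : 0 < K) (hη : 0 ≤ η)
    (hf : Measurable fun z : X × A => f z.1 z.2)
    (hR : ∀ t, Measurable fun w : History X A K t × X × A => Rhat t w.1 w.2.1 w.2.2)
    (hRB : ∀ t h x, ∀ a ∈ (π₀ x).support, |Rhat t h x a| ≤ B) (t : ℕ) :
    ∀ᵐ h ∂(historyLaw K d₀ π₀ η f Rhat t), ∀ s k, (h s).2.1 k ∈ (π₀ (h s).1).support := by
  induction t with
  | zero => exact Filter.Eventually.of_forall fun h s => s.elim0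
  | succ t ih =>
    have hS := measurableSet_history_mem_support (K := K) (π₀ := π₀) (t + 1)
    rw [ae_iff]
    change historyLaw K d₀ π₀ η f Rhat (t + 1)
      {h | ∀ s k, (h s).2.1 k ∈ (π₀ (h s).1).support}ᶜ = 0
    rw [← lintegral_indicator_one hS.compl,
      lintegral_historyLaw_succ hK hη hf hR hRB t (measurable_one.indicator hS.compl)]
    refine lintegral_eq_zero_of_ae_eq_zero ?_
    filter_upwards [ih] with h hh
    have hR1 : Measurable fun z : X × A => Rhat t h z.1 z.2 :=
      (hR t).comp (measurable_prodMk_left (x := h))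
    refine lintegral_eq_zero_of_ae_eq_zero ?_
    filter_upwards [ae_roundLaw_mem_support (K := K) (d₀ := d₀) (π₀ := π₀)
      (measurable_klTilt_policy (η := η) hR1)
      (isProbabilityMeasure_klTilt hη hR1 (hRB t h))
      (fun x => tilted_absolutelyContinuous _ _) hf] with z hz
    refine Set.indicator_of_notMem (Set.notMem_compl_iff.2 fun s => ?_) _
    refine Fin.lastCases ?_ (fun j => ?_) s
    · simpa using hz
    · simpa using hh j

/-! ### Exponential tail of the empirical excess loss -/

lemma lintegral_exp_neg_sum_excessLoss_le (hK : 0 < K) {s M m : ℝ} (hη : 0 ≤ η)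
    (hR : ∀ t, Measurable fun w : History X A K t × X × A => Rhat t w.1 w.2.1 w.2.2)
    (hRB : ∀ t h x, ∀ a ∈ (π₀ x).support, |Rhat t h x a| ≤ B)
    (hf : Measurable fun z : X × A => f z.1 z.2) (hg : Measurable fun z : X × A => g z.1 z.2)
    (hfB : ∀ x, ∀ a ∈ (π₀ x).support, |f x a| ≤ B)
    (hgB : ∀ x, ∀ a ∈ (π₀ x).support, |g x a| ≤ B)
    (hM : M = Real.log K + 2 * B) (hs : 0 ≤ s) (hsM : s * M ≤ 1)
    (hm : m ≤ (Real.exp (2 * η * B) ^ K)⁻¹ * (popLoss K d₀ π₀ f g - popLoss K d₀ π₀ f f))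
    (t : ℕ) :
    ∫⁻ h, ENNReal.ofReal (Real.exp (-(s * ∑ j, (roundLoss g (h j) - roundLoss f (h j)))))
      ∂(historyLaw K d₀ π₀ η f Rhat t) ≤ ENNReal.ofReal (Real.exp ((s * M) ^ 2 - s * m)) ^ t := by
  have hD : Measurable fun z : Round X A K => roundLoss g z - roundLoss f z :=
    (measurable_roundLoss hg).sub (measurable_roundLoss hf)
  have hmeas : ∀ t, Measurable fun h : History X A K t =>
      ENNReal.ofReal (Real.exp (-(s * ∑ j, (roundLoss g (h j) - roundLoss f (h j))))) := fun t =>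
    (Real.measurable_exp.comp ((Finset.measurable_sum _ fun j _ =>
      hD.comp (measurable_pi_apply j)).const_mul s).neg).ennreal_ofReal
  induction t with
  | zero => simp [historyLaw]
  | succ t ih =>
    rw [lintegral_historyLaw_succ hK hη hf hR hRB t (hmeas (t + 1)), pow_succ]
    have hsplit : ∀ (h : History X A K t) (z : Round X A K),
        ENNReal.ofReal (Real.exp (-(s * ∑ j,
          (roundLoss g ((Fin.snoc h z : History X A K (t + 1)) j) -
            roundLoss f ((Fin.snoc h z : History X A K (t + 1)) j))))) =
        ENNReal.ofReal (Real.exp (-(s * ∑ j, (roundLoss g (h j) - roundLoss f (h j))))) *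
          ENNReal.ofReal (Real.exp (-(s * (roundLoss g z - roundLoss f z)))) := fun h z => by
      rw [Fin.sum_univ_castSucc, ← ENNReal.ofReal_mul (Real.exp_pos _).le, ← Real.exp_add]
      simp only [Fin.snoc_castSucc, Fin.snoc_last]
      congr 2; ring
    simp only [hsplit]
    calc _ ≤ ∫⁻ h : History X A K t, ENNReal.ofReal (Real.exp (-(s * ∑ j,
            (roundLoss g (h j) - roundLoss f (h j))))) *
              ENNReal.ofReal (Real.exp ((s * M) ^ 2 - s * m))
            ∂(historyLaw K d₀ π₀ η f Rhat t) := by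
          refine lintegral_mono fun h => ?_
          rw [lintegral_const_mul' _ _ ENNReal.ofReal_ne_top]
          gcongr
          exact lintegral_exp_neg_excessLoss_le hK hη
            ((hR t).comp (measurable_prodMk_left (x := h))) (hRB t h) hf hg hfB hgB hM hs hsM hm
      _ ≤ _ := by
          rw [lintegral_mul_const' _ _ ENNReal.ofReal_ne_top]
          gcongr

lemma popLoss_sub_popLoss_le (hK : 0 < K) (hf : Measurable fun z : X × A => f z.1 z.2)
    (hg : Measurable fun z : X × A => g z.1 z.2)
    (hfB : ∀ x, ∀ a ∈ (π₀ x).support, |f x a| ≤ B)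
    (hgB : ∀ x, ∀ a ∈ (π₀ x).support, |g x a| ≤ B) :
    popLoss K d₀ π₀ f g - popLoss K d₀ π₀ f f ≤ Real.log K + 2 * B := by
  rw [popLoss_sub_popLoss hK hf hg hfB hgB]
  have := integral_mono_ae (integrable_mnlKL_slate (d₀ := d₀) (π₀ := π₀) hK hf hg hgB)
    (integrable_const (Real.log K + 2 * B)) (by
      filter_upwards [ae_slateLaw_mem_support] with z hz
      exact mnlKL_le hK fun k => hgB _ _ (hz k))
  simpa using this

/-- Chernoff bound: a reward whose excess loss in every round has conditional mean at least
`15 γ / 16` rarely has empirical excess loss at most `γ / 16`. -/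
lemma historyLaw_sum_excessLoss_le (hK : 0 < K) {γ M : ℝ} (hη : 0 ≤ η) (hγ : 0 < γ) (hB0 : 0 ≤ B)
    (hR : ∀ t, Measurable fun w : History X A K t × X × A => Rhat t w.1 w.2.1 w.2.2)
    (hRB : ∀ t h x, ∀ a ∈ (π₀ x).support, |Rhat t h x a| ≤ B)
    (hf : Measurable fun z : X × A => f z.1 z.2) (hg : Measurable fun z : X × A => g z.1 z.2)
    (hfB : ∀ x, ∀ a ∈ (π₀ x).support, |f x a| ≤ B)
    (hgB : ∀ x, ∀ a ∈ (π₀ x).support, |g x a| ≤ B)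
    (hM : M = Real.log K + 2 * B)
    (hm : 15 / 16 * γ ≤
      (Real.exp (2 * η * B) ^ K)⁻¹ * (popLoss K d₀ π₀ f g - popLoss K d₀ π₀ f f))
    (t : ℕ) :
    historyLaw K d₀ π₀ η f Rhat t
        {h | ∑ j, (roundLoss g (h j) - roundLoss f (h j)) ≤ t * (γ / 16)} ≤
      ENNReal.ofReal (Real.exp (-(γ ^ 2 / (128 * M ^ 2) * t))) := by
  have hexc0 : 0 ≤ popLoss K d₀ π₀ f g - popLoss K d₀ π₀ f f := by
    rw [popLoss_sub_popLoss hK hf hg hfB hgB]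
    exact integral_nonneg fun z => mnlKL_nonneg _ _
  have hle := popLoss_sub_popLoss_le (d₀ := d₀) (π₀ := π₀) hK hf hg hfB hgB
  have hb1 : (Real.exp (2 * η * B) ^ K)⁻¹ ≤ 1 :=
    inv_le_one_of_one_le₀ (one_le_pow₀ (Real.one_le_exp (by positivity)))
  have hγM : 15 / 16 * γ ≤ M := by
    rw [hM]
    exact hm.trans ((mul_le_of_le_one_left hexc0 hb1).trans hle)
  have hM0 : 0 < M := by linarith
  -- the exponent per round, `s b + (s M)² - s m` with `b = γ / 16` and `m = 15 γ / 16`, is then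
  -- `-12` times `γ² / (128 M²)`
  set s : ℝ := γ / (8 * M ^ 2) with hs_def
  have hs : 0 ≤ s := by positivity
  have hsM : s * M ≤ 1 := by
    have : s * M = γ / (8 * M) := by rw [hs_def]; field_simp
    rw [this, div_le_one (by positivity)]
    linarith
  have hmgf := lintegral_exp_neg_sum_excessLoss_le hK hη hR hRB hf hg hfB hgB hM hs hsM hm t
  have hmeas : Measurable fun h : History X A K t =>
      ENNReal.ofReal (Real.exp (-(s * ∑ j, (roundLoss g (h j) - roundLoss f (h j))))) :=
    (Real.measurable_exp.comp ((Finset.measurable_sum _ fun j _ =>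
      ((measurable_roundLoss hg).sub (measurable_roundLoss hf)).comp
        (measurable_pi_apply j)).const_mul s).neg).ennreal_ofReal
  have hmarkov := (mul_meas_ge_le_lintegral (μ := historyLaw K d₀ π₀ η f Rhat t) hmeas
    (ENNReal.ofReal (Real.exp (-(s * (t * (γ / 16))))))).trans hmgf
  have hsub : {h : History X A K t | ∑ j, (roundLoss g (h j) - roundLoss f (h j)) ≤ t * (γ / 16)} ⊆
      {h | ENNReal.ofReal (Real.exp (-(s * (t * (γ / 16))))) ≤
        ENNReal.ofReal (Real.exp (-(s * ∑ j, (roundLoss g (h j) - roundLoss f (h j)))))} := by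
    intro h hh
    exact ENNReal.ofReal_le_ofReal (Real.exp_le_exp.2
      (neg_le_neg (mul_le_mul_of_nonneg_left hh hs)))
  refine (measure_mono hsub).trans ?_
  have hcancel : ENNReal.ofReal (Real.exp (s * (t * (γ / 16)))) *
      ENNReal.ofReal (Real.exp (-(s * (t * (γ / 16))))) = 1 := by
    rw [← ENNReal.ofReal_mul (Real.exp_pos _).le, ← Real.exp_add, add_neg_cancel, Real.exp_zero,
      ENNReal.ofReal_one]
  have h2 := mul_le_mul_right hmarkov (ENNReal.ofReal (Real.exp (s * (t * (γ / 16)))))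
  rw [← mul_assoc, hcancel, one_mul] at h2
  refine h2.trans ?_
  rw [← ENNReal.ofReal_pow (Real.exp_pos _).le, ← Real.exp_nat_mul,
    ← ENNReal.ofReal_mul (Real.exp_pos _).le, ← Real.exp_add]
  refine ENNReal.ofReal_le_ofReal (Real.exp_le_exp.2 ?_)
  have h3 : s * (t * (γ / 16)) + t * ((s * M) ^ 2 - s * (15 / 16 * γ)) =
      -(12 * (γ ^ 2 / (128 * M ^ 2) * t)) := by
    rw [hs_def]; field_simp; ring
  have h4 : 0 ≤ γ ^ 2 / (128 * M ^ 2) * t := by positivity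
  rw [h3]; linarith

end HistoryLaw

/-! ### Identifiability and the loss gap -/

section LossGap

/-- A centered function that takes the same value at two coordinates of almost every slate of
independent draws vanishes almost everywhere. -/
lemma ae_eq_zero_of_ae_pi_eq {α : Type*} [MeasurableSpace α] {μ : Measure α}
    [IsProbabilityMeasure μ] {K : ℕ} {f : α → ℝ} (hf : Measurable f) (h0 : ∫ a, f a ∂μ = 0)
    {i j : Fin K} (hij : i ≠ j)
    (h : ∀ᵐ a ∂(Measure.pi fun _ : Fin K => μ), f (a i) = f (a j)) : f =ᵐ[μ] 0 := by
  have hind : IndepFun (fun a : Fin K → α => a i) (fun a => a j) (Measure.pi fun _ => μ) :=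
    (iIndepFun_pi (μ := fun _ : Fin K => μ) (X := fun _ => id)
      fun _ => aemeasurable_id).indepFun hij
  rw [indepFun_iff_map_prod_eq_prod_map_map (measurable_pi_apply i).aemeasurable
    (measurable_pi_apply j).aemeasurable] at hind
  have e : ∀ k : Fin K, (Measure.pi fun _ : Fin K => μ).map (fun a => a k) = μ := fun k =>
    (measurePreserving_eval (fun _ : Fin K => μ) k).map_eq
  rw [e i, e j] at hind
  have hprod : ∀ᵐ z ∂(μ.prod μ), f z.1 = f z.2 := by
    have hS : MeasurableSet {z : α × α | f z.1 = f z.2} :=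
      measurableSet_eq_fun (hf.comp measurable_fst) (hf.comp measurable_snd)
    have hm : Measurable fun a : Fin K → α => (a i, a j) := by fun_prop
    rw [← hind, ae_map_iff hm.aemeasurable hS]
    exact h
  filter_upwards [Measure.ae_ae_of_ae_prod hprod] with a ha
  have h1 : ∫ b, f b ∂μ = ∫ _b, f a ∂μ := integral_congr_ae (by
    filter_upwards [ha] with b hb using hb.symm)
  rw [h0] at h1
  simpa using h1.symm

variable {X A P : Type*} [MeasurableSpace X] [MetricSpace A] [SecondCountableTopology A]
  [MeasurableSpace A] [BorelSpace A] {K : ℕ} {d₀ : Measure X} [IsProbabilityMeasure d₀]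
  {π₀ : Kernel X A} [IsMarkovKernel π₀] {R : P → X → A → ℝ} {sel : (X → A → ℝ) → X → A}

/-- Members of the class whose choice laws have zero expected divergence have the same selector:
centering removes the additive constant that choice probabilities leave undetermined. -/
lemma ae_sel_eq_of_integral_mnlKL_eq_zero (hK : 2 ≤ K)
    (hRmeas : ∀ p, Measurable fun z : X × A => R p z.1 z.2)
    (hRcentered : ∀ p x, ∫ a, R p x a ∂(π₀ x) = 0)
    (hsel : IsArgmaxSelector π₀ (insert 0 (Set.range R)) sel)
    (hC1 : CompactContinuous d₀ π₀ R) (hC2 : HasRewardGap d₀ π₀ sel R) {p q : P}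
    (h : ∫ z, mnlKL (fun j => R p z.1 (z.2 j)) (fun j => R q z.1 (z.2 j))
      ∂(slateLaw K d₀ π₀) = 0) : sel (R p) =ᵐ[d₀] sel (R q) := by
  have hB : ∀ p x, ∀ a ∈ (π₀ x).support, |R p x a| ≤ envelope π₀ R :=
    fun p x a ha => hC1.abs_le_envelope p ha
  rw [integral_eq_zero_iff_of_nonneg (fun z => mnlKL_nonneg _ _)
    (integrable_mnlKL_slate (by omega) (hRmeas p) (hRmeas q) (hB q))] at h
  have h2 := Measure.ae_ae_of_ae_compProd h
  have hint : ∀ p x, Integrable (R p x) (π₀ x) := fun p x =>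
    Integrable.of_bound ((hRmeas p).comp measurable_prodMk_left).aestronglyMeasurable
      (envelope π₀ R) (by
        filter_upwards [Measure.support_mem_ae (μ := π₀ x)] with a ha using hB p x a ha)
  refine ae_sel_eq_of_ae_le hsel hC1 hC2 ?_
  filter_upwards [h2, hC1.continuous p, hC1.continuous q] with x hx hp hq
  have h3 : (fun a => R p x a - R q x a) =ᵐ[π₀ x] 0 := by
    refine ae_eq_zero_of_ae_pi_eq (K := K) (i := ⟨0, by omega⟩) (j := ⟨1, by omega⟩)
      (((hRmeas p).comp measurable_prodMk_left).sub ((hRmeas q).comp measurable_prodMk_left))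
      ?_ (by simp) ?_
    · rw [integral_sub (hint p x) (hint q x), hRcentered, hRcentered, sub_zero]
    · have hx' : ∀ᵐ a ∂(Measure.pi fun _ : Fin K => π₀ x),
          mnlKL (fun j => R p x (a j)) (fun j => R q x (a j)) = 0 := hx
      filter_upwards [hx'] with a ha
      exact sub_eq_sub_of_mnlKL_eq_zero ha _ _
  -- by continuity the two rewards agree on the whole support, in particular at the maximizer
  have hle : ∀ a ∈ (π₀ x).support, R q x a - R p x a ≤ 0 :=
    le_on_support_of_ae_le (hq.sub hp) (by
      filter_upwards [h3] with a ha
      have : R p x a - R q x a = 0 := ha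
      change R q x a - R p x a ≤ 0
      linarith)
  have hge : ∀ a ∈ (π₀ x).support, R p x a - R q x a ≤ 0 :=
    le_on_support_of_ae_le (hp.sub hq) (by
      filter_upwards [h3] with a ha
      exact le_of_eq ha)
  filter_upwards [Measure.support_mem_ae (μ := π₀ x)] with a ha
  have mp := hsel.mem_support (f := R p) (by simp) x
  have h4 := hle a ha
  have h5 := hge _ mp
  have h6 := hsel.le (f := R p) (by simp) ha
  linarith

/-- One-step regret bounded below forces a uniform excess of population loss: otherwise a sequence
of pairs of rewards converges, in the compact class, to a pair with zero expected divergence, which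
has a common selector; near the limit pair selectors do not change, so the regret vanishes. -/
lemma exists_hasLossGap (hK : 2 ≤ K)
    (hRmeas : ∀ p, Measurable fun z : X × A => R p z.1 z.2)
    (hRcentered : ∀ p x, ∫ a, R p x a ∂(π₀ x) = 0)
    (hsel : IsArgmaxSelector π₀ (insert 0 (Set.range R)) sel)
    (hC1 : CompactContinuous d₀ π₀ R) (hC2 : HasRewardGap d₀ π₀ sel R) {ε : ℝ} (hε : 0 < ε) :
    ∃ γ₀ : ℝ, 0 < γ₀ ∧ HasLossGap K d₀ π₀ sel R ε γ₀ := by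
  have hK0 : 0 < K := by omega
  have hB : ∀ p x, ∀ a ∈ (π₀ x).support, |R p x a| ≤ envelope π₀ R :=
    fun p x a ha => hC1.abs_le_envelope p ha
  by_contra hcon
  push Not at hcon
  have hseq : ∀ n : ℕ, ∃ pq : P × P, ε ≤ oneStepRegret d₀ sel (R pq.1) (R pq.2) ∧
      ∫ z, mnlKL (fun j => R pq.1 z.1 (z.2 j)) (fun j => R pq.2 z.1 (z.2 j))
        ∂(slateLaw K d₀ π₀) < 1 / ((n : ℝ) + 1) := fun n => by
    have := hcon (1 / ((n : ℝ) + 1)) (by positivity)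
    unfold HasLossGap at this
    push Not at this
    obtain ⟨p, q, h1, h2⟩ := this
    rw [popLoss_sub_popLoss hK0 (hRmeas p) (hRmeas q) (hB p) (hB q)] at h2
    exact ⟨(p, q), h1, h2⟩
  choose u hu1 hu2 using hseq
  obtain ⟨⟨_, _⟩, ⟨⟨p, rfl⟩, ⟨q, rfl⟩⟩, φ, hφ, hlim⟩ :=
    (hC1.compact.prod hC1.compact).tendsto_subseq
      (x := fun n => (onSupport π₀ (R (u n).1), onSupport π₀ (R (u n).2)))
      (fun n => ⟨Set.mem_range_self _, Set.mem_range_self _⟩)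
  obtain ⟨hlp, hlq⟩ := (Prod.tendsto_iff _ _).1 hlim
  have hunif : ∀ {v : ℕ → P} {r : P}, Filter.Tendsto (fun n => onSupport π₀ (R (v n)))
      Filter.atTop (nhds (onSupport π₀ (R r))) → ∀ δ : ℝ, 0 < δ →
      ∀ᶠ n in Filter.atTop, ∀ z ∈ suppGraph π₀, |R r z.1 z.2 - R (v n) z.1 z.2| < δ := by
    intro v r hv δ hδ
    rw [UniformFun.tendsto_iff_tendstoUniformly, Metric.tendstoUniformly_iff] at hv
    filter_upwards [hv δ hδ] with n hn z hz
    exact hn ⟨z, hz⟩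
  have hup := hunif (v := fun n => (u (φ n)).1) hlp
  have huq := hunif (v := fun n => (u (φ n)).2) hlq
  have hpt : ∀ {v : ℕ → P} {r : P}, (∀ δ : ℝ, 0 < δ →
      ∀ᶠ n in Filter.atTop, ∀ z ∈ suppGraph π₀, |R r z.1 z.2 - R (v n) z.1 z.2| < δ) →
      ∀ z ∈ suppGraph π₀,
        Filter.Tendsto (fun n => R (v n) z.1 z.2) Filter.atTop (nhds (R r z.1 z.2)) := by
    intro v r hv z hz
    rw [Metric.tendsto_nhds]
    intro δ hδ
    filter_upwards [hv δ hδ] with n hn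
    rw [dist_comm]
    exact hn z hz
  have hKLlim : Filter.Tendsto (fun n => ∫ z, mnlKL (fun j => R (u (φ n)).1 z.1 (z.2 j))
      (fun j => R (u (φ n)).2 z.1 (z.2 j)) ∂(slateLaw K d₀ π₀)) Filter.atTop
      (nhds (∫ z, mnlKL (fun j => R p z.1 (z.2 j)) (fun j => R q z.1 (z.2 j))
        ∂(slateLaw K d₀ π₀))) := by
    refine tendsto_integral_of_dominated_convergence
      (fun _ => Real.log K + 2 * envelope π₀ R)
      (fun n => (measurable_mnlKL_slate (hRmeas _) (hRmeas _)).aestronglyMeasurable)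
      (integrable_const _) (fun n => ?_) ?_
    · filter_upwards [ae_slateLaw_mem_support] with z hz
      rw [Real.norm_of_nonneg (mnlKL_nonneg _ _)]
      exact mnlKL_le hK0 fun k => hB _ _ _ (hz k)
    · filter_upwards [ae_slateLaw_mem_support] with z hz
      have h1 : Filter.Tendsto (fun n => fun j => R (u (φ n)).1 z.1 (z.2 j)) Filter.atTop
          (nhds fun j => R p z.1 (z.2 j)) :=
        tendsto_pi_nhds.2 fun j => hpt hup (z.1, z.2 j) (hz j)
      have h2 : Filter.Tendsto (fun n => fun j => R (u (φ n)).2 z.1 (z.2 j)) Filter.atTop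
          (nhds fun j => R q z.1 (z.2 j)) :=
        tendsto_pi_nhds.2 fun j => hpt huq (z.1, z.2 j) (hz j)
      exact tendsto_mnlKL h1 h2
  have hzero : ∫ z, mnlKL (fun j => R p z.1 (z.2 j)) (fun j => R q z.1 (z.2 j))
      ∂(slateLaw K d₀ π₀) = 0 := by
    refine tendsto_nhds_unique hKLlim (squeeze_zero
      (fun n => integral_nonneg fun z => mnlKL_nonneg _ _) (fun n => (hu2 (φ n)).le) ?_)
    exact tendsto_one_div_add_atTop_nhds_zero_nat.comp hφ.tendsto_atTop
  have hpq := ae_sel_eq_of_integral_mnlKL_eq_zero hK hRmeas hRcentered hsel hC1 hC2 hzero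
  obtain ⟨Δ, hΔ, hgap⟩ := hC2
  obtain ⟨n, hn1, hn2⟩ := ((hup Δ hΔ).and (huq Δ hΔ)).exists
  have hp := ae_sel_eq_of_close hsel hgap hn1
  have hq := ae_sel_eq_of_close hsel hgap hn2
  have := oneStepRegret_eq_zero ((hp.symm.trans hpq).trans hq)
  linarith [hu1 (φ n)]

end LossGap

/-! ### Regret of the greedy loop -/

/-- A sequence bounded by `D` and by `D N exp (-c t)` for `t ≥ 1` has sums controlled by the time at
which the exponential bound takes over, plus a geometric series. -/
lemma sum_le_of_exponential_tail {a : ℕ → ℝ} {D N c : ℝ} (hD : 0 ≤ D) (hN : 1 ≤ N) (hc : 0 < c)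
    (h1 : ∀ t, a t ≤ D) (h2 : ∀ t, 1 ≤ t → a t ≤ D * (N * Real.exp (-(c * t)))) (T : ℕ) :
    ∑ t ∈ Finset.range T, a t ≤
      D * (1 + (⌈1 / c * Real.log (2 * N)⌉ : ℝ) + 1 / (Real.exp c - 1)) := by
  set y := 1 / c * Real.log (2 * N) with hy
  have hlog : 0 ≤ Real.log (2 * N) := Real.log_nonneg (by linarith)
  have hy0 : 0 ≤ y := by positivity
  have hceil : (⌈y⌉ : ℝ) = (⌈y⌉₊ : ℝ) := (natCast_ceil_eq_intCast_ceil hy0).symm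
  have hr1 : Real.exp (-c) < 1 := by rw [Real.exp_lt_one_iff]; linarith
  let b : ℕ → ℝ := fun t => if t ≤ ⌈y⌉₊ then D else D * Real.exp (-c) ^ (t - ⌈y⌉₊)
  have hb0 : ∀ t, 0 ≤ b t := fun t => by
    simp only [b]; split_ifs
    · exact hD
    · positivity
  have hab : ∀ t, a t ≤ b t := fun t => by
    simp only [b]; split_ifs with ht
    · exact h1 t
    · push Not at ht
      refine (h2 t (by omega)).trans (mul_le_mul_of_nonneg_left ?_ hD)
      have hN0 : 0 < N := by linarith
      rw [← Real.exp_nat_mul, Nat.cast_sub ht.le, ← Real.exp_log hN0, ← Real.exp_add,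
        Real.exp_le_exp]
      have h3 : Real.log N ≤ Real.log (2 * N) := Real.log_le_log hN0 (by linarith)
      have h4 : Real.log (2 * N) ≤ c * ⌈y⌉₊ := by
        calc Real.log (2 * N) = c * y := by rw [hy]; field_simp
          _ ≤ _ := mul_le_mul_of_nonneg_left (Nat.le_ceil y) hc.le
      linarith
  calc ∑ t ∈ Finset.range T, a t ≤ ∑ t ∈ Finset.range T, b t := Finset.sum_le_sum fun t _ => hab t
    _ ≤ ∑ t ∈ Finset.range (⌈y⌉₊ + 1 + T), b t :=
        Finset.sum_le_sum_of_subset_of_nonneg (Finset.range_mono (by omega)) fun t _ _ => hb0 t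
    _ = D * (⌈y⌉₊ + 1) + ∑ j ∈ Finset.range T, D * Real.exp (-c) * Real.exp (-c) ^ j := by
        rw [Finset.sum_range_add]
        congr 1
        · rw [Finset.sum_congr rfl (g := fun _ => D) fun t ht => if_pos (by
            have := Finset.mem_range.1 ht; omega)]
          simp [mul_comm]
        · refine Finset.sum_congr rfl fun j _ => ?_
          simp only [b]
          rw [if_neg (by omega), show ⌈y⌉₊ + 1 + j - ⌈y⌉₊ = j + 1 by omega, pow_succ]
          ring
    _ ≤ D * (⌈y⌉₊ + 1) + D * Real.exp (-c) * (1 - Real.exp (-c))⁻¹ := by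
        rw [← Finset.mul_sum]
        have := sum_le_hasSum (Finset.range T) (fun j _ => pow_nonneg (Real.exp_pos (-c)).le j)
          (hasSum_geometric_of_lt_one (Real.exp_pos (-c)).le hr1)
        gcongr
    _ = _ := by
        have h5 : Real.exp (-c) * (1 - Real.exp (-c))⁻¹ = 1 / (Real.exp c - 1) := by
          have h6 : 0 < Real.exp c - 1 := by linarith [Real.add_one_lt_exp hc.ne']
          have h7 : (1 - Real.exp (-c)) ≠ 0 := by linarith
          rw [← div_eq_mul_inv, div_eq_div_iff h7 h6.ne', mul_sub, ← Real.exp_add]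
          simp
        rw [hceil, mul_assoc, h5]; ring

section Regret

variable {X A P : Type*} [MeasurableSpace X] [MetricSpace A] [SecondCountableTopology A]
  [MeasurableSpace A] [BorelSpace A] {K : ℕ} {d₀ : Measure X} [IsProbabilityMeasure d₀]
  {π₀ : Kernel X A} [IsMarkovKernel π₀] {η : ℝ} {R : P → X → A → ℝ}
  {sel : (X → A → ℝ) → X → A} {Rhat : (t : ℕ) → History X A K t → X → A → ℝ}

lemma IsERMRule.mem_insert (hRhat : IsERMRule K π₀ (Set.range R) Rhat) (t : ℕ)
    (h : History X A K t) : Rhat t h ∈ insert 0 (Set.range R) := by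
  rcases Nat.eq_zero_or_pos t with rfl | ht
  · exact Or.inl (hRhat.zero h)
  · exact Or.inr (hRhat.mem t ht h)

lemma IsERMRule.abs_le_envelope (hRhat : IsERMRule K π₀ (Set.range R) Rhat)
    (hC1 : CompactContinuous d₀ π₀ R) (t : ℕ) (h : History X A K t) (x : X) :
    ∀ a ∈ (π₀ x).support, |Rhat t h x a| ≤ envelope π₀ R := by
  intro a ha
  rcases hRhat.mem_insert t h with h0 | ⟨q, hq⟩
  · rw [h0]; simpa using envelope_nonneg
  · rw [← hq]; exact hC1.abs_le_envelope q ha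

/-- The selector itself need not depend measurably on the data, but the regret of the estimate does:
up to null sets there are finitely many selectors `a`, the regret depends only on which of them
maximizes the estimate, and "`a` maximizes the estimate almost everywhere" is a measurable event. -/
lemma IsERMRule.measurable_oneStepRegret (hRhat : IsERMRule K π₀ (Set.range R) Rhat)
    (hsel : IsArgmaxSelector π₀ (insert 0 (Set.range R)) sel)
    (hC1 : CompactContinuous d₀ π₀ R) (hC2 : HasRewardGap d₀ π₀ sel R) (p : P) (t : ℕ) :
    Measurable fun h => oneStepRegret d₀ sel (R p) (Rhat t h) := by
  rcases Nat.eq_zero_or_pos t with rfl | ht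
  · simp only [hRhat.zero]; exact measurable_const
  obtain ⟨Δ, hΔ, hgap⟩ := id hC2
  obtain ⟨-, I, -, hI⟩ := exists_finset_net hC1.compact (half_pos hΔ)
  let S : P → Set (History X A K t × X × A) := fun i =>
    {w | Rhat t w.1 w.2.1 (sel (R i) w.2.1) < Rhat t w.1 w.2.1 w.2.2}
  have hS : ∀ i, MeasurableSet (S i) := fun i =>
    measurableSet_lt ((hRhat.measurable t).comp (measurable_fst.prodMk
      ((measurable_fst.comp measurable_snd).prodMk
        ((hsel (R i) (by simp)).1.comp (measurable_fst.comp measurable_snd)))))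
      (hRhat.measurable t)
  let E : P → Set (History X A K t) := fun i => {h | (d₀ ⊗ₘ π₀) (Prod.mk h ⁻¹' S i) = 0}
  have hE : ∀ i, MeasurableSet (E i) := fun i =>
    measurable_measure_prodMk_left (hS i) (measurableSet_singleton 0)
  have hE_iff : ∀ i h, h ∈ E i ↔
      ∀ᵐ x ∂d₀, ∀ᵐ a ∂(π₀ x), Rhat t h x a ≤ Rhat t h x (sel (R i) x) := fun i h => by
    have hm : MeasurableSet {z : X × A | Rhat t h z.1 z.2 ≤ Rhat t h z.1 (sel (R i) z.1)} := by
      have := ((hS i).preimage (measurable_prodMk_left (x := h))).compl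
      convert this using 1
      ext z; simp [S]
    rw [← Measure.ae_compProd_iff
        (p := fun z => Rhat t h z.1 z.2 ≤ Rhat t h z.1 (sel (R i) z.1)) hm,
      ae_iff]
    simp only [not_le]
    rfl
  have hE_eq : ∀ i h, h ∈ E i →
      oneStepRegret d₀ sel (R p) (Rhat t h) = oneStepRegret d₀ sel (R p) (R i) := fun i h hh => by
    obtain ⟨q, hq⟩ := hRhat.mem t ht h
    have h1 := (hE_iff i h).1 hh
    rw [← hq] at h1 ⊢
    exact (oneStepRegret_congr (ae_sel_eq_of_ae_le hsel hC1 hC2 h1)).symm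
  have hcover : ∀ h, ∃ i ∈ I, h ∈ E i := fun h => by
    obtain ⟨q, hq⟩ := hRhat.mem t ht h
    obtain ⟨i, hi, hqi⟩ := hI q
    refine ⟨i, hi, (hE_iff i h).2 ?_⟩
    have h1 := ae_sel_eq_of_close hsel hgap fun z hz => (hqi z hz).trans_lt (half_lt_self hΔ)
    filter_upwards [h1] with x hx
    filter_upwards [Measure.support_mem_ae (μ := π₀ x)] with a ha
    rw [← hx, ← hq]
    exact hsel.le (by simp) ha
  intro U _
  have : (fun h => oneStepRegret d₀ sel (R p) (Rhat t h)) ⁻¹' U =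
      ⋃ i ∈ (I : Set P) ∩ {i | oneStepRegret d₀ sel (R p) (R i) ∈ U}, E i := by
    ext h
    simp only [Set.mem_preimage, Set.mem_iUnion, exists_prop]
    constructor
    · intro hU
      obtain ⟨i, hi, hhi⟩ := hcover h
      refine ⟨i, ⟨hi, ?_⟩, hhi⟩
      rw [hE_eq i h hhi] at hU
      exact hU
    · rintro ⟨i, ⟨-, hiU⟩, hhi⟩
      rw [hE_eq i h hhi]
      exact hiU
  rw [this]
  exact MeasurableSet.biUnion (I.finite_toSet.inter_of_left _).countable fun i _ => hE i

lemma IsERMRule.isProbabilityMeasure_historyLaw (hRhat : IsERMRule K π₀ (Set.range R) Rhat)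
    (hK : 0 < K) (hη : 0 ≤ η) (hRmeas : ∀ p, Measurable fun z : X × A => R p z.1 z.2)
    (hC1 : CompactContinuous d₀ π₀ R) (p : P) (t : ℕ) :
    IsProbabilityMeasure (historyLaw K d₀ π₀ η (R p) Rhat t) :=
  GreedyRLHF.isProbabilityMeasure_historyLaw hK d₀ π₀ η (R p) (hRmeas p) Rhat hRhat.measurable
    (fun t h x => integrable_exp_of_bound hη
      ((hRhat.measurable t).comp (measurable_prodMk_left (x := h))) x
      (hRhat.abs_le_envelope hC1 t h x)) t

lemma IsERMRule.integrable_oneStepRegret (hRhat : IsERMRule K π₀ (Set.range R) Rhat)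
    (hK : 0 < K) (hη : 0 ≤ η) (hRmeas : ∀ p, Measurable fun z : X × A => R p z.1 z.2)
    (hsel : IsArgmaxSelector π₀ (insert 0 (Set.range R)) sel)
    (hC1 : CompactContinuous d₀ π₀ R) (hC2 : HasRewardGap d₀ π₀ sel R) (p : P) (t : ℕ) :
    Integrable (fun h => oneStepRegret d₀ sel (R p) (Rhat t h))
      (historyLaw K d₀ π₀ η (R p) Rhat t) := by
  have := hRhat.isProbabilityMeasure_historyLaw hK hη hRmeas hC1 p t
  refine Integrable.of_bound
    (hRhat.measurable_oneStepRegret hsel hC1 hC2 p t).aestronglyMeasurable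
    (deltaMax π₀ sel R) (Filter.Eventually.of_forall fun h => ?_)
  rw [Real.norm_of_nonneg (oneStepRegret_nonneg hsel p (hRhat.mem_insert t h))]
  exact oneStepRegret_le_deltaMax hRmeas hsel hC1 p (hRhat.mem_insert t h)

/-- Data on which the empirical risk minimizer has positive regret are data on which one of the
centers of the net, with large excess population loss, has small empirical excess loss. The loss
being `2`-Lipschitz, passing from the estimate to the nearest center costs `γ / 16` in both. -/
lemma IsERMRule.exists_center (hRhat : IsERMRule K π₀ (Set.range R) Rhat) (hK : 0 < K)
    (hRmeas : ∀ p, Measurable fun z : X × A => R p z.1 z.2)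
    (hC1 : CompactContinuous d₀ π₀ R) {ε₀ γ₀ β γ : ℝ} (hgap : HasLossGap K d₀ π₀ sel R ε₀ γ₀)
    (hβ : 1 ≤ β) (hγ : γ = (β ^ K)⁻¹ * γ₀) (hγ0 : 0 < γ)
    {I : Finset P} (hI : ∀ p, ∃ i ∈ I, ∀ z ∈ suppGraph π₀, |R p z.1 z.2 - R i z.1 z.2| ≤ γ / 32)
    (p : P) {t : ℕ} (ht : 1 ≤ t) {h : History X A K t}
    (hh : ∀ s k, (h s).2.1 k ∈ (π₀ (h s).1).support)
    (hreg : ε₀ ≤ oneStepRegret d₀ sel (R p) (Rhat t h)) :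
    ∃ i ∈ I, 15 / 16 * γ ≤
        (β ^ K)⁻¹ * (popLoss K d₀ π₀ (R p) (R i) - popLoss K d₀ π₀ (R p) (R p)) ∧
      ∑ j, (roundLoss (R i) (h j) - roundLoss (R p) (h j)) ≤ t * (γ / 16) := by
  have hB : ∀ p x, ∀ a ∈ (π₀ x).support, |R p x a| ≤ envelope π₀ R :=
    fun p x a ha => hC1.abs_le_envelope p ha
  obtain ⟨q, hq⟩ := hRhat.mem t ht h
  rw [← hq] at hreg
  obtain ⟨i, hi, hqi⟩ := hI q
  refine ⟨i, hi, ?_, ?_⟩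
  · have h1 := hgap p q hreg
    rw [popLoss_sub_popLoss hK (hRmeas p) (hRmeas q) (hB p) (hB q)] at h1
    rw [popLoss_sub_popLoss hK (hRmeas p) (hRmeas i) (hB p) (hB i)]
    have hint : ∀ r, Integrable (fun z : X × (Fin K → A) =>
        mnlKL (fun j => R p z.1 (z.2 j)) (fun j => R r z.1 (z.2 j))) (slateLaw K d₀ π₀) := fun r =>
      integrable_mnlKL_slate hK (hRmeas p) (hRmeas r) (hB r)
    have h2 := integral_mono_ae (hint q) ((hint i).add (integrable_const (2 * (γ / 32)))) (by
      filter_upwards [ae_slateLaw_mem_support] with z hz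
      exact mnlKL_le_add hK fun k => hqi (z.1, z.2 k) (hz k))
    simp only [Pi.add_apply] at h2
    rw [integral_add (hint i) (integrable_const _), integral_const, probReal_univ, one_smul] at h2
    set κ := ∫ z, mnlKL (fun j => R p z.1 (z.2 j)) (fun j => R i z.1 (z.2 j)) ∂(slateLaw K d₀ π₀)
    have hb0 : 0 ≤ (β ^ K)⁻¹ := by positivity
    have hb1 : (β ^ K)⁻¹ ≤ 1 := inv_le_one_of_one_le₀ (one_le_pow₀ hβ)
    have h3 : (β ^ K)⁻¹ * γ₀ ≤ (β ^ K)⁻¹ * (κ + 2 * (γ / 32)) :=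
      mul_le_mul_of_nonneg_left (h1.trans h2) hb0
    have h4 : (β ^ K)⁻¹ * (2 * (γ / 32)) ≤ 2 * (γ / 32) :=
      mul_le_of_le_one_left (by positivity) hb1
    rw [← hγ, mul_add] at h3
    linarith
  · have ht0 : (0 : ℝ) < t := by exact_mod_cast ht
    have h1 : empRisk h (R q) ≤ empRisk h (R p) := by
      have := hRhat.isMin t ht h hh (Set.mem_range_self p)
      rwa [← hq] at this
    have h2 : ∑ j, roundLoss (R q) (h j) ≤ ∑ j, roundLoss (R p) (h j) :=
      le_of_mul_le_mul_left h1 (by positivity)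
    have h3 : ∀ j, roundLoss (R i) (h j) ≤ roundLoss (R q) (h j) + γ / 16 := fun j => by
      have := mnlLoss_le_add (v := fun k => R i (h j).1 ((h j).2.1 k))
        (w := fun k => R q (h j).1 ((h j).2.1 k)) (δ := γ / 32) (fun k => by
          rw [abs_sub_comm]
          exact hqi ((h j).1, (h j).2.1 k) (hh j k)) (h j).2.2
      unfold roundLoss
      linarith
    have h4 := Finset.sum_le_sum fun j (_ : j ∈ Finset.univ) => h3 j
    rw [Finset.sum_add_distrib, Finset.sum_const, Finset.card_univ, Fintype.card_fin,
      nsmul_eq_mul] at h4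
    rw [Finset.sum_sub_distrib]
    linarith

lemma IsERMRule.integral_oneStepRegret_le (hRhat : IsERMRule K π₀ (Set.range R) Rhat) (hK : 0 < K)
    (hη : 0 ≤ η) (hRmeas : ∀ p, Measurable fun z : X × A => R p z.1 z.2)
    (hsel : IsArgmaxSelector π₀ (insert 0 (Set.range R)) sel)
    (hC1 : CompactContinuous d₀ π₀ R) (hC2 : HasRewardGap d₀ π₀ sel R)
    {ε₀ γ₀ γ : ℝ} (hiso : IsolatesRegret d₀ sel R ε₀)
    (hgap : HasLossGap K d₀ π₀ sel R ε₀ γ₀)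
    (hγ : γ = (Real.exp (2 * η * envelope π₀ R) ^ K)⁻¹ * γ₀) (hγ0 : 0 < γ)
    {I : Finset P} (hI : ∀ p, ∃ i ∈ I, ∀ z ∈ suppGraph π₀, |R p z.1 z.2 - R i z.1 z.2| ≤ γ / 32)
    (p : P) {t : ℕ} (ht : 1 ≤ t) :
    ∫ h, oneStepRegret d₀ sel (R p) (Rhat t h) ∂(historyLaw K d₀ π₀ η (R p) Rhat t) ≤
      deltaMax π₀ sel R * (I.card *
        Real.exp (-(γ ^ 2 / (128 * (Real.log K + 2 * envelope π₀ R) ^ 2) * t))) := by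
  classical
  have hB : ∀ p x, ∀ a ∈ (π₀ x).support, |R p x a| ≤ envelope π₀ R :=
    fun p x a ha => hC1.abs_le_envelope p ha
  have hRB := fun t h x => hRhat.abs_le_envelope hC1 t h x
  have hprob := hRhat.isProbabilityMeasure_historyLaw hK hη hRmeas hC1 p t
  set μ := historyLaw K d₀ π₀ η (R p) Rhat t with hμ
  set D := deltaMax π₀ sel R
  set c := γ ^ 2 / (128 * (Real.log K + 2 * envelope π₀ R) ^ 2)
  set G : History X A K t → ℝ := fun h => oneStepRegret d₀ sel (R p) (Rhat t h)
  have hGm : Measurable G := hRhat.measurable_oneStepRegret hsel hC1 hC2 p t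
  have hS : MeasurableSet {h | ε₀ ≤ G h} := measurableSet_le measurable_const hGm
  have hD0 : 0 ≤ D := (oneStepRegret_nonneg (d₀ := d₀) hsel p (by simp : R p ∈ _)).trans
    (oneStepRegret_le_deltaMax hRmeas hsel hC1 p (by simp))
  have hle : ∫ h, G h ∂μ ≤ D * μ.real {h | ε₀ ≤ G h} := by
    have h1 := integral_mono (μ := μ) (hRhat.integrable_oneStepRegret hK hη hRmeas hsel hC1 hC2 p t)
      ((integrable_const D).indicator hS) (fun h => by
        obtain ⟨q, hq⟩ := hRhat.mem t ht h
        by_cases hh : ε₀ ≤ G h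
        · rw [Set.indicator_of_mem (by exact hh)]
          exact oneStepRegret_le_deltaMax hRmeas hsel hC1 p (hRhat.mem_insert t h)
        · rw [Set.indicator_of_notMem (by exact hh)]
          have h2 := hiso p q
          rw [hq] at h2
          exact (h2.resolve_right hh).le)
    rwa [integral_indicator_const _ hS, smul_eq_mul, mul_comm] at h1
  refine hle.trans (mul_le_mul_of_nonneg_left ?_ hD0)
  let I' := I.filter fun i => 15 / 16 * γ ≤ (Real.exp (2 * η * envelope π₀ R) ^ K)⁻¹ *
    (popLoss K d₀ π₀ (R p) (R i) - popLoss K d₀ π₀ (R p) (R p))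
  have hμle : μ {h | ε₀ ≤ G h} ≤ ENNReal.ofReal (I.card * Real.exp (-(c * t))) := by
    calc μ {h | ε₀ ≤ G h}
        ≤ μ (⋃ i ∈ I', {h | ∑ j, (roundLoss (R i) (h j) - roundLoss (R p) (h j)) ≤
            t * (γ / 16)}) := by
          refine measure_mono_ae ?_
          filter_upwards [ae_historyLaw_mem_support hK hη (hRmeas p) hRhat.measurable hRB t]
            with h hh hreg
          obtain ⟨i, hi, h1, h2⟩ := hRhat.exists_center hK hRmeas hC1 hgap
            (Real.one_le_exp (mul_nonneg (by positivity) envelope_nonneg)) hγ hγ0 hI p ht hh hreg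
          exact Set.mem_biUnion (Finset.mem_filter.2 ⟨hi, h1⟩) h2
      _ ≤ ∑ i ∈ I', μ {h | ∑ j, (roundLoss (R i) (h j) - roundLoss (R p) (h j)) ≤
            t * (γ / 16)} := measure_biUnion_finset_le _ _
      _ ≤ ∑ _i ∈ I', ENNReal.ofReal (Real.exp (-(c * t))) := Finset.sum_le_sum fun i hi =>
          historyLaw_sum_excessLoss_le hK hη hγ0 envelope_nonneg hRhat.measurable hRB (hRmeas p)
            (hRmeas i) (hB p) (hB i) rfl (Finset.mem_filter.1 hi).2 t
      _ ≤ ∑ _i ∈ I, ENNReal.ofReal (Real.exp (-(c * t))) :=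
          Finset.sum_le_sum_of_subset (Finset.filter_subset _ _)
      _ = _ := by
          rw [Finset.sum_const, nsmul_eq_mul, ENNReal.ofReal_mul (by positivity),
            ENNReal.ofReal_natCast]
  exact ENNReal.toReal_le_of_le_ofReal (by positivity) hμle

end Regret

end GreedyRLHF

theorem mainTheorem1
    {X A P : Type*} [MeasurableSpace X]
    [MetricSpace A] [TopologicalSpace.SeparableSpace A] [MeasurableSpace A] [BorelSpace A]
    (d₀ : Measure X) [IsProbabilityMeasure d₀]
    (π₀ : Kernel X A) [IsMarkovKernel π₀]
    (K : ℕ) (hK : 2 ≤ K) (η : ℝ) (hη : 0 < η)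
    (R : P → X → A → ℝ)
    (hRmeas : ∀ p, Measurable fun z : X × A => R p z.1 z.2)
    (hRcentered : ∀ p x, ∫ a, R p x a ∂(π₀ x) = 0)
    (sel : (X → A → ℝ) → X → A)
    (hsel : IsArgmaxSelector π₀ (insert 0 (Set.range R)) sel)
    (hC1 : CompactContinuous d₀ π₀ R)
    (hC2 : HasRewardGap d₀ π₀ sel R)
    (Rhat : (t : ℕ) → History X A K t → X → A → ℝ)
    (hRhat : IsERMRule K π₀ (Set.range R) Rhat) :
    (∀ p t, Integrable (fun h => oneStepRegret d₀ sel (R p) (Rhat t h))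
      (historyLaw K d₀ π₀ η (R p) Rhat t)) ∧
    (∃ C : ℝ, ∀ p, ∀ T : ℕ, 1 ≤ T → cumRegret K d₀ π₀ η sel (R p) Rhat T ≤ C) ∧
    (∃ ε₀ : ℝ, 0 < ε₀ ∧ IsolatesRegret d₀ sel R ε₀) ∧
    (∀ ε₀ : ℝ, 0 < ε₀ → ∃ γ₀ : ℝ, 0 < γ₀ ∧ HasLossGap K d₀ π₀ sel R ε₀ γ₀) ∧
    (∀ ε₀ γ₀ : ℝ, 0 < ε₀ → IsolatesRegret d₀ sel R ε₀ →
      0 < γ₀ → HasLossGap K d₀ π₀ sel R ε₀ γ₀ →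
      ∀ (B β γ c : ℝ) (N : ℕ∞),
        B = envelope π₀ R →
        β = Real.exp (2 * η * B) →
        γ = (β ^ K)⁻¹ * γ₀ →
        N = Metric.coveringNumber (Real.toNNReal (γ / 32)) (classOnSupport π₀ R) →
        c = γ ^ 2 / (128 * (Real.log K + 2 * B) ^ 2) →
        N ≠ ⊤ ∧
        ∀ p, ∀ T : ℕ, 1 ≤ T →
          cumRegret K d₀ π₀ η sel (R p) Rhat T ≤
            deltaMax π₀ sel R *
              (1 + (⌈1 / c * Real.log (2 * (N.toNat : ℝ))⌉ : ℝ) + 1 / (Real.exp c - 1))) := by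
  have : SecondCountableTopology A := UniformSpace.secondCountable_of_separable A
  have hK0 : 0 < K := by omega
  have hiso := exists_isolatesRegret hRmeas hsel hC1 hC2
  have hlossGap : ∀ ε₀ : ℝ, 0 < ε₀ → ∃ γ₀ : ℝ, 0 < γ₀ ∧ HasLossGap K d₀ π₀ sel R ε₀ γ₀ :=
    fun ε₀ hε₀ => exists_hasLossGap hK hRmeas hRcentered hsel hC1 hC2 hε₀
  have hmain : ∀ ε₀ γ₀ : ℝ, 0 < ε₀ → IsolatesRegret d₀ sel R ε₀ →
      0 < γ₀ → HasLossGap K d₀ π₀ sel R ε₀ γ₀ →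
      ∀ (B β γ c : ℝ) (N : ℕ∞),
        B = envelope π₀ R →
        β = Real.exp (2 * η * B) →
        γ = (β ^ K)⁻¹ * γ₀ →
        N = Metric.coveringNumber (Real.toNNReal (γ / 32)) (classOnSupport π₀ R) →
        c = γ ^ 2 / (128 * (Real.log K + 2 * B) ^ 2) →
        N ≠ ⊤ ∧
        ∀ p, ∀ T : ℕ, 1 ≤ T →
          cumRegret K d₀ π₀ η sel (R p) Rhat T ≤
            deltaMax π₀ sel R *
              (1 + (⌈1 / c * Real.log (2 * (N.toNat : ℝ))⌉ : ℝ) + 1 / (Real.exp c - 1)) := by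
    rintro ε₀ γ₀ - hε hγ₀ hgap B β γ c N rfl rfl hγ rfl rfl
    have hγ0 : 0 < γ := by rw [hγ]; positivity
    obtain ⟨hfin, I, hcard, hI⟩ := exists_finset_net hC1.compact
      (div_pos hγ0 (by norm_num : (0 : ℝ) < 32))
    refine ⟨hfin, fun p T _ => ?_⟩
    have hcard' : (I.card : ℝ) ≤
        ((Metric.coveringNumber (γ / 32).toNNReal (classOnSupport π₀ R)).toNat : ℝ) := by
      rw [← ENat.natCast_toNat hfin] at hcard
      exact_mod_cast hcard
    have hI1 : (1 : ℝ) ≤ I.card := by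
      obtain ⟨i, hi, -⟩ := hI p
      exact_mod_cast Finset.card_pos.2 ⟨i, hi⟩
    have hD0 : 0 ≤ deltaMax π₀ sel R :=
      (oneStepRegret_nonneg (d₀ := d₀) hsel p (by simp : R p ∈ _)).trans
        (oneStepRegret_le_deltaMax hRmeas hsel hC1 p (by simp))
    have hlogK : 0 < Real.log K := Real.log_pos (by exact_mod_cast (by omega : 1 < K))
    have hB0 : 0 ≤ envelope π₀ R := envelope_nonneg
    refine sum_le_of_exponential_tail hD0 (hI1.trans hcard') (by positivity) (fun t => ?_)
      (fun t ht => ?_) T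
    · have := hRhat.isProbabilityMeasure_historyLaw hK0 hη.le hRmeas hC1 p t
      have h1 := integral_mono
        (hRhat.integrable_oneStepRegret hK0 hη.le hRmeas hsel hC1 hC2 p t)
        (integrable_const (deltaMax π₀ sel R))
        (fun h => oneStepRegret_le_deltaMax hRmeas hsel hC1 p (hRhat.mem_insert t h))
      simpa using h1
    · refine (hRhat.integral_oneStepRegret_le hK0 hη.le hRmeas hsel hC1 hC2 hε hgap hγ hγ0 hI p
        ht).trans ?_
      gcongr
  refine ⟨fun p t => hRhat.integrable_oneStepRegret hK0 hη.le hRmeas hsel hC1 hC2 p t, ?_, hiso,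
    hlossGap, hmain⟩
  obtain ⟨ε₀, hε₀, hε⟩ := hiso
  obtain ⟨γ₀, hγ₀, hgap⟩ := hlossGap ε₀ hε₀
  exact ⟨_, (hmain ε₀ γ₀ hε₀ hε hγ₀ hgap _ _ _ _ _ rfl rfl rfl rfl rfl).2⟩
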